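/- Let $n\in\mathbb N$, $\hbar>0$, and let $H\in\mathcal S'(\mathbb R^{2n})$ be any (complex) tempered distribution; write $z=(x,p)$ and $\sigma(z,z')=p\cdot x'-p'\cdot x$. The *Weyl operator* $\widehat H:\mathcal S(\mathbb R^n)\to\mathcal S'(\mathbb R^n)$ with symbol $H$ is the operator with distributional kernel $$\mathcal K(x,y)=(2\pi\hbar)^{-n}\int e^{\frac i\hbar p\cdot(x-y)}H(\tfrac12(x+y),p)\,dp .$$ The *star operator* $\widetilde H=H\star:\mathcal S(\mathbb R^{2n})\to\mathcal S'(\mathbb R^{2n})$ is given by the Moyal product $$(H\star\Psi)(z)=(4\pi\hbar)^{-2n}\iint e^{\frac{i}{2\hbar}\sigma(u,v)}H(z+\tfrac12u)\Psi(z-\tfrac12v)\,du\,dv ,$$ both formulas being read in the sense of distributions. For $\phi\in\mathcal S(\mathbb R^n)$ with $\|\phi\|_{L^2}=1$, let $W_\phi:L^2(\mathbb R^n)\to L^2(\mathbb R^{2n})$ be the isometry that extends by continuity the normalized cross-Wigner transform $$W_\phi\psi(x,p)=(2\pi\hbar)^{-n/2}\int e^{-\frac i\hbar p\cdot y}\,\psi(x+\tfrac12y)\,\overline{\phi(x-\tfrac12y)}\,dy\qquad(\psi\in\mathcal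 S(\mathbb R^n)),$$ and let $W_\phi^*:L^2(\mathbb R^{2n})\to L^2(\mathbb R^n)$ be its Hilbert space adjoint. A linear operator $A:\mathcal S(\mathbb R^m)\to\mathcal S'(\mathbb R^m)$ is read as an operator in $L^2(\mathbb R^m)$, given by a graph in $L^2\times L^2$, in any one of the following three ways: * *Schwartz*: the pairs $(\psi,f)$ with $\psi\in\mathcal S$, $f\in L^2$ and $A\psi=f$ in $\mathcal S'$; * *closure*: the closure in $L^2\times L^2$ of the previous graph; * *maximal*: the pairs $(\psi,f)\in L^2\times L^2$ for which $A\psi=f$ holds weakly, that is, $(\psi|g)=(f|\chi)$ for all $\chi\in\mathcal S$, $g\in L^2$ such that $\langle A\theta,\overline\chi\rangle=(\theta|g)$ for all $\theta\in\mathcal S$ (where $(f|g)=\int f\overline g$). An *eigenfunction* with eigenvalue $\lambda\in\mathbb C$ is a $\psi\in L^2$ with $\psi\ne0$ and $(\psi,\lambda\psi)$ in the graph. Then, for each of the three readings, applied to both $\widehat H$ and $\widetilde H$: 1. $\widehat H$ and $\widetilde H$ have the same eigenvalues. 2. If $\psi$ is an eigenfunction of $\widehat H$ with eigenvalue $\lambda$,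 then for every $\phi\in\mathcal S(\mathbb R^n)$ with $\|\phi\|_{L^2}=1$ the function $W_\phi\psi$ is an eigenfunction of $\widetilde H$ with eigenvalue $\lambda$. 3. Conversely, let $\Psi$ be an eigenfunction of $\widetilde H$ with eigenvalue $\lambda$. Then for every $\phi\in\mathcal S(\mathbb R^n)$ with $\|\phi\|_{L^2}=1$ and $W_\phi^*\Psi\neq0$, the function $W_\phi^*\Psi$ is an eigenfunction of $\widehat H$ with eigenvalue $\lambda$; and there is at least one such $\phi$. -/

import Mathlib

open MeasureTheory SchwartzMap
open scoped ContDiff SchwartzMap RealInnerProductSpace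

noncomputable section

namespace PhaseSpace

namespace PartialFourier

set_option linter.unusedSectionVars false

variable {V E X : Type} [NormedAddCommGroup V] [NormedSpace ℝ V]
  [NormedAddCommGroup E] [InnerProductSpace ℝ E] [FiniteDimensional ℝ E]
  [MeasurableSpace E] [BorelSpace E]
  [NormedAddCommGroup X] [NormedSpace ℝ X] [NormedSpace ℂ X] [IsScalarTower ℝ ℂ X]

def osc (κ t : ℝ) : ℂ := Complex.exp (-((κ * t : ℝ) : ℂ) * Complex.I)

theorem norm_osc (κ t : ℝ) : ‖osc κ t‖ = 1 := by
  have := Complex.norm_exp_ofReal_mul_I (-(κ * t))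
  simpa [osc] using this

theorem continuous_osc (κ : ℝ) : Continuous (osc κ) := by
  unfold osc; fun_prop

theorem hasDerivAt_osc (κ t : ℝ) :
    HasDerivAt (osc κ) (-(κ : ℂ) * Complex.I * osc κ t) t := by
  have h1 : HasDerivAt (fun t : ℝ => (κ * t : ℝ)) κ t := by
    simpa using (hasDerivAt_id t).const_mul κ
  have h2 := ((h1.ofReal_comp).neg.mul_const Complex.I).cexp
  convert! h2 using 1
  exact mul_comm _ _

/-- The integral `∫ exp(-i κ ⟨y, p⟩) U(x, y) dy` at `z = (x, p)`. -/
def pfun (κ : ℝ) (U : V × E → X) (z : V × E) : X :=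
  ∫ y, osc κ ⟪y, z.2⟫ • U (z.1, y)

theorem decay_aux (m : ℕ) (U : 𝓢(V × E, X)) (x : V) (y : E) :
    ‖x‖ ^ m * ‖U (x, y)‖ ≤ (1 + ‖y‖) ^ (-((volume : Measure E).integrablePower : ℝ)) *
      (2 ^ (m + (volume : Measure E).integrablePower) *
        ((Finset.Iic (m + (volume : Measure E).integrablePower, 0)).sup
          (schwartzSeminormFamily ℝ (V × E) X)) U) := by
  set N := (volume : Measure E).integrablePower
  have h := one_add_le_sup_seminorm_apply (𝕜 := ℝ) (m := (m + N, 0)) le_rfl le_rfl U (x, y)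
  rw [norm_iteratedFDeriv_zero] at h
  rw [Real.rpow_neg (by positivity), ← div_eq_inv_mul, le_div_iff₀' (by positivity),
    Real.rpow_natCast]
  refine le_trans ?_ h
  have hx : ‖x‖ ≤ 1 + ‖(x, y)‖ := (norm_fst_le (x, y)).trans (by linarith)
  have hy : 1 + ‖y‖ ≤ 1 + ‖(x, y)‖ := by linarith [norm_snd_le (x, y)]
  rw [← mul_assoc, pow_add, mul_comm ((1 + ‖y‖) ^ N)]
  gcongr

theorem integrable_slice (U : 𝓢(V × E, X)) (x : V) : Integrable (fun y => U (x, y)) := by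
  have h := (Measure.integrable_pow_neg_integrablePower (volume : Measure E)).mul_const
    (2 ^ (0 + (volume : Measure E).integrablePower) *
        ((Finset.Iic (0 + (volume : Measure E).integrablePower, 0)).sup
          (schwartzSeminormFamily ℝ (V × E) X)) U)
  refine h.mono' (U.continuous.comp (by fun_prop)).aestronglyMeasurable
    (Filter.Eventually.of_forall fun y => ?_)
  simpa only [pow_zero, one_mul] using decay_aux 0 U x y

theorem integrable_osc_smul (κ : ℝ) (U : 𝓢(V × E, X)) (z : V × E) :
    Integrable (fun y => osc κ ⟪y, z.2⟫ • U (z.1, y)) := by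
  refine (integrable_slice U z.1).norm.mono' ?_ (Filter.Eventually.of_forall fun y => ?_)
  · exact (((continuous_osc κ).comp (by fun_prop)).smul
      (U.continuous.comp (by fun_prop))).aestronglyMeasurable
  · rw [norm_smul, norm_osc, one_mul]

/-- The symbol `(dx-part of dU) - i κ ⟨y, ·⟩ U` of the derivative of `pfun U`. -/
def D (κ : ℝ) : 𝓢(V × E, X) →L[ℝ] 𝓢(V × E, (V × E) →L[ℝ] X) :=
  (postcompCLM (𝕜 := ℝ) ((ContinuousLinearMap.compL ℝ (V × E) (V × E) X).flip
      ((ContinuousLinearMap.inl ℝ V E).comp (ContinuousLinearMap.fst ℝ V E)))).comp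
    (fderivCLM ℝ (V × E) X) +
  (postcompCLM (𝕜 := ℝ) (((-(κ : ℂ) * Complex.I) • ContinuousLinearMap.id ℂ
      ((V × E) →L[ℝ] X)).restrictScalars ℝ)).comp
    (smulRightCLM ℝ X ((innerSL ℝ).bilinearComp (ContinuousLinearMap.snd ℝ V E)
      (ContinuousLinearMap.snd ℝ V E)))

theorem D_apply (κ : ℝ) (U : 𝓢(V × E, X)) (z : V × E) :
    D κ U z = (fderiv ℝ U z).comp
        ((ContinuousLinearMap.inl ℝ V E).comp (ContinuousLinearMap.fst ℝ V E)) +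
      (-(κ : ℂ) * Complex.I) • (((innerSL ℝ).bilinearComp (ContinuousLinearMap.snd ℝ V E)
      (ContinuousLinearMap.snd ℝ V E)) z).smulRight (U z) := by
  rfl

theorem hasFDerivAt_integrand (κ : ℝ) (U : 𝓢(V × E, X)) (y : E) (z : V × E) :
    HasFDerivAt (fun z : V × E => osc κ ⟪y, z.2⟫ • U (z.1, y))
      (osc κ ⟪y, z.2⟫ • D κ U (z.1, y)) z := by
  have h1 : HasFDerivAt (fun z : V × E => (⟪y, z.2⟫ : ℝ))
      ((innerSL ℝ y).comp (ContinuousLinearMap.snd ℝ V E)) z :=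
    ((innerSL ℝ y).comp (ContinuousLinearMap.snd ℝ V E)).hasFDerivAt
  have h2 := (hasDerivAt_osc κ ⟪y, z.2⟫).hasFDerivAt.comp z h1
  have h3 : HasFDerivAt (fun z : V × E => (z.1, y))
      ((ContinuousLinearMap.inl ℝ V E).comp (ContinuousLinearMap.fst ℝ V E)) z := by
    have := (ContinuousLinearMap.fst ℝ V E).hasFDerivAt (x := z) |>.prodMk
      (hasFDerivAt_const y z)
    convert! this using 1
  have h4 := (U.hasFDerivAt (z.1, y)).comp z h3
  have h5 := h2.smul h4
  convert! h5 using 1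
  rw [D_apply]
  ext w
  · simp
  · simp only [ContinuousLinearMap.comp_apply, smul_apply, add_apply,
      ContinuousLinearMap.inr_apply, ContinuousLinearMap.coe_fst', ContinuousLinearMap.coe_snd',
      ContinuousLinearMap.smulRight_apply, Function.comp_apply,
      ContinuousLinearMap.toSpanSingleton_apply, map_zero, smul_zero, zero_add,
      ContinuousLinearMap.bilinearComp_apply, innerSL_apply_apply]
    have e : ∀ (r : ℝ) (c d : ℂ) (v : X), c • d • r • v = (r • (d * c)) • v := by
      intro r c d v
      rw [← algebraMap_smul ℂ r v, smul_smul, smul_smul, Complex.real_smul]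
      congr 1
      simp only [Complex.coe_algebraMap]
      ring
    exact e _ _ _ _

variable [CompleteSpace X]

theorem hasFDerivAt_pfun (κ : ℝ) (U : 𝓢(V × E, X)) (z : V × E) :
    HasFDerivAt (pfun κ U) (pfun κ (D κ U) z) z := by
  have h := (Measure.integrable_pow_neg_integrablePower (volume : Measure E)).mul_const
    (2 ^ (0 + (volume : Measure E).integrablePower) *
        ((Finset.Iic (0 + (volume : Measure E).integrablePower, 0)).sup
          (schwartzSeminormFamily ℝ (V × E) ((V × E) →L[ℝ] X))) (D κ U))
  refine hasFDerivAt_integral_of_dominated_of_fderiv_le (𝕜 := ℝ)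
    (F := fun (z : V × E) (y : E) => osc κ ⟪y, z.2⟫ • U (z.1, y))
    (F' := fun (z : V × E) (y : E) => osc κ ⟪y, z.2⟫ • D κ U (z.1, y))
    (s := Set.univ) Filter.univ_mem
    (Filter.Eventually.of_forall fun z => (integrable_osc_smul κ U z).aestronglyMeasurable)
    (integrable_osc_smul κ U z) (integrable_osc_smul κ (D κ U) z).aestronglyMeasurable
    (Filter.Eventually.of_forall fun y z _ => ?_)
    h (Filter.Eventually.of_forall fun y z _ => hasFDerivAt_integrand κ U y z)
  rw [norm_smul, norm_osc, one_mul]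
  simpa only [pow_zero, one_mul] using decay_aux 0 (D κ U) z.1 y

theorem fderiv_pfun (κ : ℝ) (U : 𝓢(V × E, X)) :
    fderiv ℝ (pfun κ U) = pfun κ (D κ U) :=
  funext fun z => (hasFDerivAt_pfun κ U z).fderiv

theorem contDiff_pfun (κ : ℝ) (n : ℕ) : ∀ {X : Type} [NormedAddCommGroup X] [NormedSpace ℝ X]
    [NormedSpace ℂ X] [IsScalarTower ℝ ℂ X] [CompleteSpace X] (U : 𝓢(V × E, X)),
    ContDiff ℝ n (pfun κ U) := by
  induction n with
  | zero =>
    intro X _ _ _ _ _ U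
    exact contDiff_zero.2 (continuous_iff_continuousAt.2
      fun z => (hasFDerivAt_pfun κ U z).continuousAt)
  | succ n ih =>
    intro X _ _ _ _ _ U
    push_cast
    rw [contDiff_succ_iff_fderiv]
    refine ⟨fun z => (hasFDerivAt_pfun κ U z).differentiableAt, by simp, ?_⟩
    rw [fderiv_pfun]
    exact ih _

/-- The `y`-derivative as a vector-valued Schwartz function. -/
def Dy : 𝓢(V × E, X) →L[ℝ] 𝓢(V × E, E →L[ℝ] X) :=
  (postcompCLM (𝕜 := ℝ) ((ContinuousLinearMap.compL ℝ E (V × E) X).flip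
      (ContinuousLinearMap.inr ℝ V E))).comp (fderivCLM ℝ (V × E) X)

theorem Dy_apply (U : 𝓢(V × E, X)) (z : V × E) :
    Dy U z = (fderiv ℝ U z).comp (ContinuousLinearMap.inr ℝ V E) := rfl

theorem pfun_Dy (κ : ℝ) (U : 𝓢(V × E, X)) (z : V × E) :
    pfun κ (Dy U) z = ((κ : ℂ) * Complex.I) • (innerSL ℝ z.2).smulRight (pfun κ U z) := by
  ext a
  have hint := integrable_osc_smul κ (Dy U) z
  rw [pfun, ContinuousLinearMap.integral_apply hint]
  have hU : ∀ y, HasFDerivAt (fun y => U (z.1, y)) (Dy U (z.1, y)) y := by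
    intro y
    have h3 : HasFDerivAt (fun y : E => (z.1, y)) (ContinuousLinearMap.inr ℝ V E) y := by
      have := (hasFDerivAt_const z.1 y).prodMk (hasFDerivAt_id (𝕜 := ℝ) y)
      convert! this using 1
    exact (U.hasFDerivAt (z.1, y)).comp y h3
  have ho : ∀ y : E, HasFDerivAt (fun y : E => osc κ ⟪y, z.2⟫)
      ((innerSL ℝ z.2).smulRight (-(κ : ℂ) * Complex.I * osc κ ⟪y, z.2⟫)) y := by
    intro y
    have h1 : HasFDerivAt (fun y : E => (⟪y, z.2⟫ : ℝ)) (innerSL ℝ z.2) y := by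
      have := (innerSL ℝ z.2).hasFDerivAt (x := y)
      convert! this using 1
      ext y; simp [real_inner_comm]
    have := (hasDerivAt_osc κ ⟪y, z.2⟫).hasFDerivAt.comp y h1
    convert! this using 1
  have key := integral_bilinear_hasFDerivAt_right_eq_neg_left_of_integrable (μ := volume)
    (f := fun y : E => osc κ ⟪y, z.2⟫) (g := fun y => U (z.1, y)) (v := a)
    (B := ContinuousLinearMap.lsmul ℝ ℂ (E := X)) (f' := _) (g' := _)
    ?_ ?_ ?_ (fun y _ => ho y) (fun y _ => hU y)
  · simp only [ContinuousLinearMap.lsmul_apply] at key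
    simp only [smul_apply]
    rw [key, pfun]
    simp only [ContinuousLinearMap.smulRight_apply, innerSL_apply_apply, smul_assoc, mul_smul]
    rw [integral_smul, integral_smul, integral_smul]
    rw [neg_smul, smul_neg, neg_neg]
    rw [smul_comm (⟪z.2, a⟫ : ℝ) (κ : ℂ), smul_comm (⟪z.2, a⟫ : ℝ) Complex.I]
  · simp only [ContinuousLinearMap.lsmul_apply, ContinuousLinearMap.smulRight_apply, smul_assoc,
      mul_smul]
    exact (((integrable_osc_smul κ U z).smul Complex.I).smul (-(κ : ℂ))).smul _
  · exact hint.apply_continuousLinearMap a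
  · exact integrable_osc_smul κ U z

theorem norm_pfun_Dy (κ : ℝ) (U : 𝓢(V × E, X)) (z : V × E) :
    ‖pfun κ (Dy U) z‖ = |κ| * (‖z.2‖ * ‖pfun κ U z‖) := by
  rw [pfun_Dy, norm_smul, ContinuousLinearMap.norm_smulRight_apply, innerSL_apply_norm]
  simp

theorem sup_comp_le {A B Y : Type} [NormedAddCommGroup A] [NormedSpace ℝ A]
    [NormedAddCommGroup B] [NormedSpace ℝ B] [NormedAddCommGroup Y] [NormedSpace ℝ Y]
    (T : 𝓢(A, X) →L[ℝ] 𝓢(B, Y)) (s : Finset (ℕ × ℕ)) :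
    ∃ (s' : Finset (ℕ × ℕ)) (C : ℝ), 0 ≤ C ∧ ∀ U,
      s.sup (schwartzSeminormFamily ℝ B Y) (T U) ≤
        C * s'.sup (schwartzSeminormFamily ℝ A X) U := by
  have hb : Seminorm.IsBounded (schwartzSeminormFamily ℝ A X)
      (schwartzSeminormFamily ℝ B Y) T.toLinearMap := by
    intro i
    obtain ⟨s, C, -, h⟩ := Seminorm.bound_of_continuous (schwartz_withSeminorms ℝ A X)
      ((schwartzSeminormFamily ℝ B Y i).comp T.toLinearMap)
      (((schwartz_withSeminorms ℝ B Y).continuous_seminorm i).comp T.continuous)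
    exact ⟨s, C, h⟩
  obtain ⟨C, s', h⟩ := Seminorm.isBounded_sup hb s
  exact ⟨s', C, C.2, fun U => h U⟩

theorem bound_fst (κ : ℝ) (m : ℕ) : ∃ (s : Finset (ℕ × ℕ)) (C : ℝ), 0 ≤ C ∧
    ∀ (U : 𝓢(V × E, X)) (z : V × E),
      ‖z.1‖ ^ m * ‖pfun κ U z‖ ≤ C * s.sup (schwartzSeminormFamily ℝ (V × E) X) U := by
  set N := (volume : Measure E).integrablePower with hN
  set c : ℝ := ∫ y : E, (1 + ‖y‖) ^ (-(N : ℝ)) with hc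
  have hc0 : 0 ≤ c := integral_nonneg fun y => by positivity
  refine ⟨Finset.Iic (m + N, 0), c * 2 ^ (m + N), by positivity, fun U z => ?_⟩
  have h := (Measure.integrable_pow_neg_integrablePower (volume : Measure E)).mul_const
    (2 ^ (m + N) * ((Finset.Iic (m + N, 0)).sup (schwartzSeminormFamily ℝ (V × E) X)) U)
  calc ‖z.1‖ ^ m * ‖pfun κ U z‖
      ≤ ‖z.1‖ ^ m * ∫ y, ‖U (z.1, y)‖ := by
        gcongr
        refine (norm_integral_le_integral_norm _).trans (le_of_eq ?_)
        simp only [norm_smul, norm_osc, one_mul]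
    _ = ∫ y, ‖z.1‖ ^ m * ‖U (z.1, y)‖ := (integral_const_mul _ _).symm
    _ ≤ ∫ y : E, (1 + ‖y‖) ^ (-(N : ℝ)) * (2 ^ (m + N) *
        ((Finset.Iic (m + N, 0)).sup (schwartzSeminormFamily ℝ (V × E) X)) U) :=
        integral_mono ((integrable_slice U z.1).norm.const_mul _) h
          fun y => decay_aux m U z.1 y
    _ = _ := by rw [integral_mul_const, mul_assoc]

theorem bound_snd {κ : ℝ} (hκ : κ ≠ 0) (m : ℕ) : ∀ {X : Type} [NormedAddCommGroup X]
    [NormedSpace ℝ X] [NormedSpace ℂ X] [IsScalarTower ℝ ℂ X] [CompleteSpace X],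
    ∃ (s : Finset (ℕ × ℕ)) (C : ℝ), 0 ≤ C ∧ ∀ (U : 𝓢(V × E, X)) (z : V × E),
      ‖z.2‖ ^ m * ‖pfun κ U z‖ ≤ C * s.sup (schwartzSeminormFamily ℝ (V × E) X) U := by
  induction m with
  | zero =>
    intro X _ _ _ _ _
    simpa using bound_fst (V := V) (E := E) (X := X) κ 0
  | succ m ih =>
    intro X _ _ _ _ _
    obtain ⟨s, C, hC, h⟩ := ih (X := E →L[ℝ] X)
    obtain ⟨s', C', hC', h'⟩ := sup_comp_le (Dy (V := V) (E := E) (X := X)) s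
    refine ⟨s', |κ|⁻¹ * (C * C'), by positivity, fun U z => ?_⟩
    have h1 := h (Dy U) z
    rw [norm_pfun_Dy] at h1
    have hk : 0 < |κ| := abs_pos.2 hκ
    rw [mul_assoc, ← div_eq_inv_mul, le_div_iff₀' hk, mul_assoc]
    calc |κ| * (‖z.2‖ ^ (m + 1) * ‖pfun κ U z‖)
        = ‖z.2‖ ^ m * (|κ| * (‖z.2‖ * ‖pfun κ U z‖)) := by ring
      _ ≤ C * s.sup (schwartzSeminormFamily ℝ (V × E) (E →L[ℝ] X)) (Dy U) := h1
      _ ≤ C * (C' * s'.sup (schwartzSeminormFamily ℝ (V × E) X) U) := by gcongr; exact h' U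
      _ = _ := by ring

theorem bound_pfun {κ : ℝ} (hκ : κ ≠ 0) (m k : ℕ) : ∀ {X : Type} [NormedAddCommGroup X]
    [NormedSpace ℝ X] [NormedSpace ℂ X] [IsScalarTower ℝ ℂ X] [CompleteSpace X],
    ∃ (s : Finset (ℕ × ℕ)) (C : ℝ), 0 ≤ C ∧ ∀ (U : 𝓢(V × E, X)) (z : V × E),
      ‖z‖ ^ m * ‖iteratedFDeriv ℝ k (pfun κ U) z‖ ≤
        C * s.sup (schwartzSeminormFamily ℝ (V × E) X) U := by
  induction k with
  | zero =>
    intro X _ _ _ _ _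
    obtain ⟨s, C, hC, h⟩ := bound_fst (V := V) (E := E) (X := X) κ m
    obtain ⟨s', C', hC', h'⟩ := bound_snd (V := V) (E := E) hκ m (X := X)
    refine ⟨s ∪ s', C + C', by positivity, fun U z => ?_⟩
    rw [norm_iteratedFDeriv_zero, Prod.norm_def]
    have e1 : s.sup (schwartzSeminormFamily ℝ (V × E) X) U ≤
        (s ∪ s').sup (schwartzSeminormFamily ℝ (V × E) X) U :=
      Seminorm.le_def.1 (Finset.sup_mono Finset.subset_union_left) U
    have e2 : s'.sup (schwartzSeminormFamily ℝ (V × E) X) U ≤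
        (s ∪ s').sup (schwartzSeminormFamily ℝ (V × E) X) U :=
      Seminorm.le_def.1 (Finset.sup_mono Finset.subset_union_right) U
    have e0 : 0 ≤ (s ∪ s').sup (schwartzSeminormFamily ℝ (V × E) X) U := apply_nonneg _ _
    rcases max_cases ‖z.1‖ ‖z.2‖ with ⟨e, -⟩ | ⟨e, -⟩ <;> rw [e]
    · refine (h U z).trans ?_
      gcongr
      linarith
    · refine (h' U z).trans ?_
      gcongr
      linarith
  | succ k ih =>
    intro X _ _ _ _ _
    obtain ⟨s, C, hC, h⟩ := ih (X := (V × E) →L[ℝ] X)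
    obtain ⟨s', C', hC', h'⟩ := sup_comp_le (D (V := V) (E := E) (X := X) κ) s
    refine ⟨s', C * C', by positivity, fun U z => ?_⟩
    rw [← norm_iteratedFDeriv_fderiv, fderiv_pfun, mul_assoc]
    refine (h (D κ U) z).trans ?_
    gcongr
    exact h' U

end PartialFourier

section

variable {V E : Type} [NormedAddCommGroup V] [NormedSpace ℝ V]
  [NormedAddCommGroup E] [InnerProductSpace ℝ E] [FiniteDimensional ℝ E]
  [MeasurableSpace E] [BorelSpace E]

/-- The partial Fourier transform `F ↦ ((x, p) ↦ ∫ exp(-i κ ⟨y, p⟩) F(x, y) dy)`. -/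
def partialFourier {κ : ℝ} (hκ : κ ≠ 0) : 𝓢(V × E, ℂ) →L[ℂ] 𝓢(V × E, ℂ) :=
  mkCLM (fun F => PartialFourier.pfun κ F)
    (fun F G z => by
      simp only [PartialFourier.pfun, add_apply, smul_add]
      exact integral_add (PartialFourier.integrable_osc_smul κ F z)
        (PartialFourier.integrable_osc_smul κ G z))
    (fun a F z => by
      simp only [PartialFourier.pfun, smul_apply, RingHom.id_apply]
      rw [← integral_smul]
      simp only [smul_comm a])
    (fun F => contDiff_infty.2 fun n => PartialFourier.contDiff_pfun κ n F)
    (fun m => by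
      obtain ⟨s, C, hC, h⟩ := PartialFourier.bound_pfun (V := V) (E := E) hκ m.1 m.2 (X := ℂ)
      refine ⟨s, C, hC, fun F z => ?_⟩
      have e : s.sup (schwartzSeminormFamily ℝ (V × E) ℂ) F =
          s.sup (schwartzSeminormFamily ℂ (V × E) ℂ) F := by
        rw [Seminorm.finset_sup_apply, Seminorm.finset_sup_apply]
        rfl
      rw [← e]
      exact h F z)

theorem partialFourier_apply {κ : ℝ} (hκ : κ ≠ 0) (F : 𝓢(V × E, ℂ)) (z : V × E) :
    partialFourier hκ F z =
      ∫ y, Complex.exp (-((κ * ⟪y, z.2⟫ : ℝ) : ℂ) * Complex.I) * F (z.1, y) := rfl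


end

/-- The pull-back of a Schwartz function along an injective linear map. -/
def pullback {A B : Type} [NormedAddCommGroup A] [NormedSpace ℝ A] [FiniteDimensional ℝ A]
    [NormedAddCommGroup B] [NormedSpace ℝ B] (L : A →L[ℝ] B) (hL : Function.Injective L) :
    𝓢(B, ℂ) →L[ℂ] 𝓢(A, ℂ) :=
  compCLMOfAntilipschitz ℂ L.hasTemperateGrowth
    (L.toLinearMap.injective_iff_antilipschitz.1 hL).choose_spec.2

theorem pullback_apply {A B : Type} [NormedAddCommGroup A] [NormedSpace ℝ A]
    [FiniteDimensional ℝ A] [NormedAddCommGroup B] [NormedSpace ℝ B] (L : A →L[ℝ] B)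
    (hL : Function.Injective L) (f : 𝓢(B, ℂ)) (a : A) : pullback L hL f a = f (L a) := rfl

theorem norm_iteratedFDeriv_comp_clm_le {A B : Type} [NormedAddCommGroup A] [NormedSpace ℝ A]
    [NormedAddCommGroup B] [NormedSpace ℝ B] (L : A →L[ℝ] B) (hL : ‖L‖ ≤ 1) (f : 𝓢(B, ℂ))
    (i : ℕ) (a : A) :
    ‖iteratedFDeriv ℝ i (fun a => f (L a)) a‖ ≤ ‖iteratedFDeriv ℝ i f (L a)‖ := by
  have h := L.iteratedFDeriv_comp_right (f.smooth ⊤) a (i := i) (mod_cast le_top)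
  rw [Function.comp_def] at h
  rw [h]
  refine (ContinuousMultilinearMap.norm_compContinuousLinearMap_le _ _).trans ?_
  refine mul_le_of_le_one_right (norm_nonneg _) ?_
  exact Finset.prod_le_one (fun _ _ => norm_nonneg _) fun _ _ => hL

/-- The partial function `y ↦ F(x, y)` of a Schwartz function. -/
def slice {A B : Type} [NormedAddCommGroup A] [NormedSpace ℝ A] [NormedAddCommGroup B]
    [NormedSpace ℝ B] (x : A) (F : 𝓢(A × B, ℂ)) : 𝓢(B, ℂ) :=
  compCLMOfAntilipschitz ℂ (g := fun y : B => (x, y)) (K := 1)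
    ((Function.HasTemperateGrowth.const (x, 0)).add
      (ContinuousLinearMap.inr ℝ A B).hasTemperateGrowth |> fun h => by
        convert! h using 1; ext z <;> simp)
    (AntilipschitzWith.of_le_mul_dist fun a b => by simp [Prod.dist_eq]) F

theorem slice_apply {A B : Type} [NormedAddCommGroup A] [NormedSpace ℝ A] [NormedAddCommGroup B]
    [NormedSpace ℝ B] (x : A) (F : 𝓢(A × B, ℂ)) (y : B) : slice x F y = F (x, y) := rfl

/-- The tensor product `(f ⊗ g)(x, y) = f(x) g(y)` of two Schwartz functions. -/
def tensor {A B : Type} [NormedAddCommGroup A] [NormedSpace ℝ A]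
    [NormedAddCommGroup B] [NormedSpace ℝ B] : 𝓢(A, ℂ) →ₗ[ℂ] 𝓢(B, ℂ) →L[ℂ] 𝓢(A × B, ℂ) where
  toFun f := mkCLM (fun g z => f z.1 * g z.2) (fun g g' z => by simp [mul_add])
    (fun a g z => by simp; ring)
    (fun g => ((f.smooth ⊤).comp contDiff_fst).mul ((g.smooth ⊤).comp contDiff_snd)) <| by
      rintro ⟨m, k⟩
      refine ⟨Finset.Iic (m, k), ∑ i ∈ Finset.range (k + 1), (k.choose i : ℝ) *
        (SchwartzMap.seminorm ℂ m i f + SchwartzMap.seminorm ℂ 0 i f), ?_, fun g z => ?_⟩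
      · exact Finset.sum_nonneg fun i _ => mul_nonneg (by positivity)
          (add_nonneg (apply_nonneg _ _) (apply_nonneg _ _))
      have hs : ∀ a b : ℕ, a ≤ m → b ≤ k → SchwartzMap.seminorm ℂ a b g ≤
          (Finset.Iic (m, k)).sup (schwartzSeminormFamily ℂ B ℂ) g := fun a b ha hb =>
        Seminorm.le_def.1 (Finset.le_sup (f := schwartzSeminormFamily ℂ B ℂ)
          (Finset.mem_Iic.2 (Prod.mk_le_mk.2 ⟨ha, hb⟩))) g
      have h0 := norm_iteratedFDeriv_mul_le (𝕜 := ℝ)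
        ((f.smooth ⊤).comp (contDiff_fst (E := A) (F := B)))
        ((g.smooth ⊤).comp (contDiff_snd (E := A) (F := B))) z (n := k) (mod_cast le_top)
      have hm : ‖z‖ ^ m ≤ ‖z.1‖ ^ m + ‖z.2‖ ^ m := by
        rw [Prod.norm_def]
        rcases max_cases ‖z.1‖ ‖z.2‖ with ⟨e, -⟩ | ⟨e, -⟩ <;> rw [e]
        · linarith [pow_nonneg (norm_nonneg z.2) m]
        · linarith [pow_nonneg (norm_nonneg z.1) m]
      calc _ ≤ ‖z‖ ^ m * _ := mul_le_mul_of_nonneg_left h0 (by positivity)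
        _ = ∑ i ∈ Finset.range (k + 1), ‖z‖ ^ m * ((k.choose i : ℝ) *
            ‖iteratedFDeriv ℝ i (f ∘ Prod.fst) z‖ *
            ‖iteratedFDeriv ℝ (k - i) (g ∘ Prod.snd) z‖) := Finset.mul_sum _ _ _
        _ ≤ ∑ i ∈ Finset.range (k + 1), (k.choose i : ℝ) *
            (SchwartzMap.seminorm ℂ m i f + SchwartzMap.seminorm ℂ 0 i f) *
              (Finset.Iic (m, k)).sup (schwartzSeminormFamily ℂ B ℂ) g := by
          refine Finset.sum_le_sum fun i _ => ?_
          have e1 : ‖iteratedFDeriv ℝ i (f ∘ Prod.fst) z‖ ≤ ‖iteratedFDeriv ℝ i f z.1‖ :=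
            norm_iteratedFDeriv_comp_clm_le (ContinuousLinearMap.fst ℝ A B)
              (ContinuousLinearMap.norm_fst_le ..) f i z
          have e2 : ‖iteratedFDeriv ℝ (k - i) (g ∘ Prod.snd) z‖ ≤
              ‖iteratedFDeriv ℝ (k - i) g z.2‖ :=
            norm_iteratedFDeriv_comp_clm_le (ContinuousLinearMap.snd ℝ A B)
              (ContinuousLinearMap.norm_snd_le ..) g (k - i) z
          have a1 := f.le_seminorm ℂ m i z.1
          have a2 := f.norm_iteratedFDeriv_le_seminorm ℂ i z.1
          have b1 := (g.le_seminorm ℂ m (k - i) z.2).trans (hs m (k - i) le_rfl (by omega))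
          have b2 := (g.norm_iteratedFDeriv_le_seminorm ℂ (k - i) z.2).trans
            (hs 0 (k - i) (by omega) (by omega))
          set S := (Finset.Iic (m, k)).sup (schwartzSeminormFamily ℂ B ℂ) g
          set u := ‖iteratedFDeriv ℝ i f z.1‖
          set v := ‖iteratedFDeriv ℝ (k - i) g z.2‖
          have hu : 0 ≤ u := norm_nonneg _
          have hv : 0 ≤ v := norm_nonneg _
          calc ‖z‖ ^ m * ((k.choose i : ℝ) * ‖iteratedFDeriv ℝ i (f ∘ Prod.fst) z‖ *
                ‖iteratedFDeriv ℝ (k - i) (g ∘ Prod.snd) z‖)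
              ≤ (‖z.1‖ ^ m + ‖z.2‖ ^ m) * ((k.choose i : ℝ) * u * v) := by gcongr
            _ = (k.choose i : ℝ) * ((‖z.1‖ ^ m * u) * v + u * (‖z.2‖ ^ m * v)) := by ring
            _ ≤ (k.choose i : ℝ) * (SchwartzMap.seminorm ℂ m i f * S +
                SchwartzMap.seminorm ℂ 0 i f * S) := by gcongr
            _ = _ := by ring
        _ = _ := (Finset.sum_mul _ _ _).symm
  map_add' f f' := by
    ext g z
    exact add_mul _ _ _
  map_smul' a f := by
    ext g z
    exact mul_assoc _ _ _

theorem tensor_apply {A B : Type} [NormedAddCommGroup A] [NormedSpace ℝ A]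
    [NormedAddCommGroup B] [NormedSpace ℝ B] (f : 𝓢(A, ℂ)) (g : 𝓢(B, ℂ)) (z : A × B) :
    tensor f g z = f z.1 * g z.2 := rfl

/-- The complex conjugate of a Schwartz function. -/
def conjS {A : Type} [NormedAddCommGroup A] [NormedSpace ℝ A] (f : 𝓢(A, ℂ)) : 𝓢(A, ℂ) :=
  postcompCLM (𝕜 := ℝ) (Complex.conjCLE : ℂ →L[ℝ] ℂ) f

theorem conjS_apply {A : Type} [NormedAddCommGroup A] [NormedSpace ℝ A] (f : 𝓢(A, ℂ)) (x : A) :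
    conjS f x = starRingEnd ℂ (f x) := rfl

/-- Configuration space `ℝⁿ`. -/
abbrev Config (n : ℕ) : Type := EuclideanSpace ℝ (Fin n)

/-- Phase space `ℝⁿ × ℝⁿ`, with points `z = (x, p)` and Lebesgue measure. -/
abbrev Phase (n : ℕ) : Type := Config n × Config n

instance instHaarPhase (n : ℕ) : (volume : Measure (Phase n)).IsAddHaarMeasure :=
  Measure.prod.instIsAddHaarMeasure volume volume

variable {n : ℕ}

/-- The standard symplectic form `σ((x, p), (x', p')) = p · x' - p' · x`. -/
def sympl (z w : Phase n) : ℝ := ⟪z.2, w.1⟫ - ⟪w.2, z.1⟫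

/-- The linear map `(x, y) ↦ (x + y/2, x - y/2)`. -/
def midMap (n : ℕ) : Phase n →L[ℝ] Phase n :=
  ContinuousLinearMap.prod
    (ContinuousLinearMap.fst ℝ _ _ + (1 / 2 : ℝ) • ContinuousLinearMap.snd ℝ _ _)
    (ContinuousLinearMap.fst ℝ _ _ - (1 / 2 : ℝ) • ContinuousLinearMap.snd ℝ _ _)

theorem midMap_injective : Function.Injective (midMap n) := by
  rw [injective_iff_map_eq_zero]
  rintro ⟨x, y⟩ h
  have h1 : x + (1 / 2 : ℝ) • y = 0 := congrArg Prod.fst h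
  have h2 : x - (1 / 2 : ℝ) • y = 0 := congrArg Prod.snd h
  have hx : x = 0 := by
    have h3 : x = (1 / 2 : ℝ) • ((x + (1 / 2 : ℝ) • y) + (x - (1 / 2 : ℝ) • y)) := by module
    rw [h3, h1, h2]; simp
  have hy : y = 0 := by
    have h3 : y = (x + (1 / 2 : ℝ) • y) - (x - (1 / 2 : ℝ) • y) := by module
    rw [h3, h1, h2]; simp
  rw [hx, hy]; rfl

/-- The bilinear cross-Wigner form
`B(f, g)(x, p) = (2πħ)⁻ⁿ ∫ exp(-i p·y/ħ) f(x + y/2) g(x - y/2) dy`. -/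
def wignerForm {ħ : ℝ} (hħ : 0 < ħ) : 𝓢(Config n, ℂ) →ₗ[ℂ] 𝓢(Config n, ℂ) →L[ℂ] 𝓢(Phase n, ℂ) where
  toFun f := (((2 * Real.pi * ħ) ^ n : ℝ)⁻¹ : ℂ) •
    ((partialFourier (inv_ne_zero hħ.ne')).comp
      ((pullback (midMap n) midMap_injective).comp (tensor f)))
  map_add' f f' := by ext1 g; simp
  map_smul' a f := by
    ext1 g
    simp only [map_smul, ContinuousLinearMap.comp_smul, RingHom.id_apply, smul_comm a]

theorem wignerForm_apply {ħ : ℝ} (hħ : 0 < ħ) (f g : 𝓢(Config n, ℂ)) (z : Phase n) :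
    wignerForm hħ f g z = (((2 * Real.pi * ħ) ^ n : ℝ)⁻¹ : ℂ) *
      ∫ y, Complex.exp (-((ħ⁻¹ * ⟪y, z.2⟫ : ℝ) : ℂ) * Complex.I) *
        (f (z.1 + (1 / 2 : ℝ) • y) * g (z.1 - (1 / 2 : ℝ) • y)) := rfl

/-- The cross-Wigner transform `W(ψ, φ)`, as a linear map in `ψ`. -/
def crossWigner {ħ : ℝ} (hħ : 0 < ħ) (φ : 𝓢(Config n, ℂ)) :
    𝓢(Config n, ℂ) →ₗ[ℂ] 𝓢(Phase n, ℂ) where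
  toFun ψ := wignerForm hħ ψ (conjS φ)
  map_add' ψ ψ' := by simp
  map_smul' a ψ := by simp

/-- The normalized transform `W_φ ψ = (2πħ)^{n/2} W(ψ, φ)`. -/
def wignerTransform {ħ : ℝ} (hħ : 0 < ħ) (φ : 𝓢(Config n, ℂ)) :
    𝓢(Config n, ℂ) →ₗ[ℂ] 𝓢(Phase n, ℂ) :=
  (((2 * Real.pi * ħ) ^ ((n : ℝ) / 2) : ℝ) : ℂ) • crossWigner hħ φ

theorem wignerTransform_apply {ħ : ℝ} (hħ : 0 < ħ) (φ ψ : 𝓢(Config n, ℂ)) (z : Phase n) :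
    wignerTransform hħ φ ψ z = (((2 * Real.pi * ħ) ^ (-((n : ℝ) / 2)) : ℝ) : ℂ) *
      ∫ y, Complex.exp (-((ħ⁻¹ * ⟪y, z.2⟫ : ℝ) : ℂ) * Complex.I) *
        (ψ (z.1 + (1 / 2 : ℝ) • y) * starRingEnd ℂ (φ (z.1 - (1 / 2 : ℝ) • y))) := by
  have h0 : 0 < 2 * Real.pi * ħ := by positivity
  have h1 : wignerTransform hħ φ ψ z = (((2 * Real.pi * ħ) ^ ((n : ℝ) / 2) : ℝ) : ℂ) *
    wignerForm hħ ψ (conjS φ) z := rfl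
  rw [h1, wignerForm_apply, ← mul_assoc]
  congr 1
  rw [← Complex.ofReal_inv, ← Complex.ofReal_mul]
  congr 1
  rw [← Real.rpow_natCast, ← Real.rpow_neg h0.le, ← Real.rpow_add h0]
  congr 1
  ring

/-- The linear map `((z, v₁), v₂) ↦ (z - (v₁, v₂)/2, z)`. -/
def shiftMap (n : ℕ) : (Phase n × Config n) × Config n →L[ℝ] Phase n × Phase n :=
  let z := (ContinuousLinearMap.fst ℝ (Phase n) (Config n)).comp
    (ContinuousLinearMap.fst ℝ (Phase n × Config n) (Config n))
  let v := ((ContinuousLinearMap.snd ℝ (Phase n) (Config n)).comp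
    (ContinuousLinearMap.fst ℝ (Phase n × Config n) (Config n))).prod
      (ContinuousLinearMap.snd ℝ (Phase n × Config n) (Config n))
  ContinuousLinearMap.prod (z - (1 / 2 : ℝ) • v) z

theorem shiftMap_apply (z : Phase n) (a b : Config n) :
    shiftMap n ((z, a), b) = (z - (1 / 2 : ℝ) • (a, b), z) := rfl

theorem shiftMap_injective : Function.Injective (shiftMap n) := by
  rintro ⟨⟨z, a⟩, b⟩ ⟨⟨z', a'⟩, b'⟩ h
  rw [shiftMap_apply, shiftMap_apply, Prod.mk.injEq] at h
  obtain ⟨h1, rfl⟩ := h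
  have h2 : (a, b) = (a', b') :=
    smul_right_injective _ (by norm_num : (1 / 2 : ℝ) ≠ 0) (sub_right_injective h1)
  rw [Prod.mk.injEq] at h2
  rw [h2.1, h2.2]

/-- The linear map `((z, q), v) ↦ ((z, v), q)`. -/
def swapMap (n : ℕ) :
    (Phase n × Config n) × Config n →L[ℝ] (Phase n × Config n) × Config n :=
  let z := (ContinuousLinearMap.fst ℝ (Phase n) (Config n)).comp
    (ContinuousLinearMap.fst ℝ (Phase n × Config n) (Config n))
  let q := (ContinuousLinearMap.snd ℝ (Phase n) (Config n)).comp
    (ContinuousLinearMap.fst ℝ (Phase n × Config n) (Config n))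
  (z.prod (ContinuousLinearMap.snd ℝ (Phase n × Config n) (Config n))).prod q

theorem swapMap_apply (z : Phase n) (a b : Config n) :
    swapMap n ((z, a), b) = ((z, b), a) := rfl

theorem swapMap_injective : Function.Injective (swapMap n) := by
  rintro ⟨⟨z, a⟩, b⟩ ⟨⟨z', a'⟩, b'⟩ h
  simp only [swapMap_apply, Prod.mk.injEq] at h ⊢
  tauto

/-- The linear map `(w, z) ↦ ((z, x), -p)` with `(x, p) = w - z`. -/
def evalMap (n : ℕ) : Phase n × Phase n →L[ℝ] (Phase n × Config n) × Config n :=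
  let d := ContinuousLinearMap.fst ℝ (Phase n) (Phase n) -
    ContinuousLinearMap.snd ℝ (Phase n) (Phase n)
  ((ContinuousLinearMap.snd ℝ (Phase n) (Phase n)).prod
    ((ContinuousLinearMap.fst ℝ (Config n) (Config n)).comp d)).prod
    (-((ContinuousLinearMap.snd ℝ (Config n) (Config n)).comp d))

theorem evalMap_apply (w z : Phase n) :
    evalMap n (w, z) = ((z, (w - z).1), -(w - z).2) := rfl

theorem evalMap_injective : Function.Injective (evalMap n) := by
  rintro ⟨w, z⟩ ⟨w', z'⟩ h
  simp only [evalMap_apply, Prod.mk.injEq, neg_inj] at h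
  obtain ⟨⟨rfl, h1⟩, h2⟩ := h
  have : w - z = w' - z := Prod.ext h1 h2
  rw [sub_left_injective this]

theorem integral_phase {F : Type} [NormedAddCommGroup F] [NormedSpace ℝ F]
    (f : Phase n → F) (hf : Integrable f) : ∫ z, f z = ∫ x, ∫ p, f (x, p) :=
  integral_prod f hf

/-- The function `(w, z) ↦ ∫ exp(i σ(w - z, v)/ħ) Ψ(z - v/2) X(z) dv` on `ℝ²ⁿ × ℝ²ⁿ`, see
`moyalKernel_apply`. -/
def moyalKernel {ħ : ℝ} (hħ : 0 < ħ) :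
    𝓢(Phase n, ℂ) →ₗ[ℂ] 𝓢(Phase n, ℂ) →L[ℂ] 𝓢(Phase n × Phase n, ℂ) where
  toFun Ψ := (pullback (evalMap n) evalMap_injective).comp
    ((partialFourier (inv_ne_zero hħ.ne')).comp ((pullback (swapMap n) swapMap_injective).comp
      ((partialFourier (inv_ne_zero hħ.ne')).comp
        ((pullback (shiftMap n) shiftMap_injective).comp (tensor Ψ)))))
  map_add' Ψ Ψ' := by ext1 X; simp
  map_smul' a Ψ := by
    ext1 X
    simp only [map_smul, ContinuousLinearMap.comp_smul, RingHom.id_apply]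


theorem moyalKernel_apply {ħ : ℝ} (hħ : 0 < ħ) (Ψ X : 𝓢(Phase n, ℂ)) (w z : Phase n) :
    moyalKernel hħ Ψ X (w, z) =
      ∫ v : Phase n, Complex.exp (((ħ⁻¹ * sympl (w - z) v : ℝ) : ℂ) * Complex.I) *
        (Ψ (z - (1 / 2 : ℝ) • v) * X z) := by
  have hint : Integrable (fun v : Phase n =>
      Complex.exp (((ħ⁻¹ * sympl (w - z) v : ℝ) : ℂ) * Complex.I) *
        (Ψ (z - (1 / 2 : ℝ) • v) * X z)) := by
    have h1 : Integrable (fun v : Phase n => Ψ (z - (1 / 2 : ℝ) • v) * X z) := by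
      have := (((Ψ.integrable (μ := volume)).comp_add_left z).comp_smul
        (by norm_num : (-(1 / 2) : ℝ) ≠ 0)).mul_const (X z)
      simpa only [neg_smul, ← sub_eq_add_neg] using this
    refine h1.norm.mono' ?_ (Filter.Eventually.of_forall fun v => ?_)
    · refine Continuous.aestronglyMeasurable ?_
      have := Ψ.continuous
      unfold sympl
      fun_prop
    · rw [norm_mul, Complex.norm_exp_ofReal_mul_I, one_mul]
  rw [integral_phase _ hint]
  have h0 : moyalKernel hħ Ψ X (w, z) =
      ∫ a : Config n, Complex.exp (-((ħ⁻¹ * ⟪a, -(w - z).2⟫ : ℝ) : ℂ) * Complex.I) *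
        ∫ b : Config n, Complex.exp (-((ħ⁻¹ * ⟪b, (w - z).1⟫ : ℝ) : ℂ) * Complex.I) *
          (Ψ (z - (1 / 2 : ℝ) • (a, b)) * X z) := rfl
  rw [h0]
  refine integral_congr_ae (Filter.Eventually.of_forall fun a => ?_)
  simp only
  rw [← integral_const_mul]
  refine integral_congr_ae (Filter.Eventually.of_forall fun b => ?_)
  simp only
  rw [← mul_assoc, ← Complex.exp_add]
  congr 2
  simp only [sympl, inner_neg_right, Prod.fst_sub, Prod.snd_sub, real_inner_comm a]
  push_cast
  ring

/-- Integration of a Schwartz function over its second variable. -/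
def integrateOut {A : Type} [NormedAddCommGroup A] [NormedSpace ℝ A] [FiniteDimensional ℝ A] :
    𝓢(A × Config n, ℂ) →L[ℂ] 𝓢(A, ℂ) :=
  (pullback (ContinuousLinearMap.inl ℝ A (Config n)) (Prod.mk_left_injective 0)).comp
    (partialFourier one_ne_zero)

theorem integrateOut_apply {A : Type} [NormedAddCommGroup A] [NormedSpace ℝ A]
    [FiniteDimensional ℝ A] (F : 𝓢(A × Config n, ℂ)) (x : A) :
    integrateOut F x = ∫ y, F (x, y) := by
  have h : integrateOut F x = ∫ y : Config n,
    Complex.exp (-((1 * ⟪y, (0 : Config n)⟫ : ℝ) : ℂ) * Complex.I) * F (x, y) := rfl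
  rw [h]
  simp

/-- The linear map `((w, x), p) ↦ (w, (x, p))`. -/
def assocMap (n : ℕ) : (Phase n × Config n) × Config n →L[ℝ] Phase n × Phase n :=
  (ContinuousLinearEquiv.prodAssoc ℝ (Phase n) (Config n) (Config n) :
    (Phase n × Config n) × Config n →L[ℝ] Phase n × Phase n)

theorem assocMap_injective : Function.Injective (assocMap n) :=
  (ContinuousLinearEquiv.prodAssoc ℝ (Phase n) (Config n) (Config n)).injective

/-- The test function against which `H` is paired in `⟨H ⋆ Ψ, X⟩`:
`w ↦ (2πħ)⁻²ⁿ ∫ (∫ exp(i σ(w - z, v)/ħ) Ψ(z - v/2) dv) X(z) dz`, see `moyalForm_apply`. -/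
def moyalForm {ħ : ℝ} (hħ : 0 < ħ) :
    𝓢(Phase n, ℂ) →ₗ[ℂ] 𝓢(Phase n, ℂ) →L[ℂ] 𝓢(Phase n, ℂ) where
  toFun Ψ := (((2 * Real.pi * ħ) ^ (2 * n) : ℝ)⁻¹ : ℂ) • (integrateOut.comp (integrateOut.comp
    ((pullback (assocMap n) assocMap_injective).comp (moyalKernel hħ Ψ))))
  map_add' Ψ Ψ' := by ext1 X; simp
  map_smul' a Ψ := by
    ext1 X
    simp only [map_smul, ContinuousLinearMap.comp_smul, RingHom.id_apply, smul_comm a]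

theorem moyalForm_apply {ħ : ℝ} (hħ : 0 < ħ) (Ψ X : 𝓢(Phase n, ℂ)) (w : Phase n) :
    moyalForm hħ Ψ X w = (((2 * Real.pi * ħ) ^ (2 * n) : ℝ)⁻¹ : ℂ) *
      ∫ z : Phase n, (∫ v : Phase n,
        Complex.exp (((ħ⁻¹ * sympl (w - z) v : ℝ) : ℂ) * Complex.I) *
          Ψ (z - (1 / 2 : ℝ) • v)) * X z := by
  have hint : Integrable (fun z : Phase n => moyalKernel hħ Ψ X (w, z)) :=
    (slice w (moyalKernel hħ Ψ X)).integrable (μ := volume)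
  have h0 : moyalForm hħ Ψ X w = (((2 * Real.pi * ħ) ^ (2 * n) : ℝ)⁻¹ : ℂ) *
      integrateOut (integrateOut (pullback (assocMap n) assocMap_injective
        (moyalKernel hħ Ψ X))) w := rfl
  rw [h0, integrateOut_apply]
  congr 1
  simp only [integrateOut_apply, pullback_apply]
  calc (∫ x, ∫ p, moyalKernel hħ Ψ X (w, (x, p))) = ∫ z, moyalKernel hħ Ψ X (w, z) :=
        (integral_phase _ hint).symm
    _ = _ := by
        refine integral_congr_ae (Filter.Eventually.of_forall fun z => ?_)
        simp only [moyalKernel_apply]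
        rw [← integral_mul_const]
        simp only [mul_assoc]

/-- The Weyl operator with symbol `H`. Its distributional kernel is
`K(x, y) = (2πħ)⁻ⁿ ∫ exp(i p·(x - y)/ħ) H((x + y)/2, p) dp`, so that
`⟨Ĥ ψ, χ⟩ = ∬ K(x, y) ψ(y) χ(x) dx dy = ⟨H, B(ψ, χ)⟩` with `B` as in `wignerForm`
(put `x = m - s/2`, `y = m + s/2`). -/
def weylOp {ħ : ℝ} (hħ : 0 < ħ) (H : 𝓢'(Phase n, ℂ)) :
    𝓢(Config n, ℂ) →ₗ[ℂ] 𝓢'(Config n, ℂ) where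
  toFun ψ := PointwiseConvergenceCLM.precomp ℂ (wignerForm hħ ψ) H
  map_add' ψ ψ' := by
    ext χ
    change H (wignerForm hħ (ψ + ψ') χ) = H (wignerForm hħ ψ χ) + H (wignerForm hħ ψ' χ)
    rw [map_add, add_apply, map_add]
  map_smul' a ψ := by
    ext χ
    change H (wignerForm hħ (a • ψ) χ) = a • H (wignerForm hħ ψ χ)
    rw [map_smul, smul_apply, map_smul]

theorem weylOp_apply {ħ : ℝ} (hħ : 0 < ħ) (H : 𝓢'(Phase n, ℂ)) (ψ χ : 𝓢(Config n, ℂ)) :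
    weylOp hħ H ψ χ = H (wignerForm hħ ψ χ) := rfl

/-- The star operator `Ψ ↦ H ⋆ Ψ`, with the Moyal product
`(H ⋆ Ψ)(z) = (4πħ)⁻²ⁿ ∬ exp(i σ(u, v)/(2ħ)) H(z + u/2) Ψ(z - v/2) du dv`.
With `w = z + u/2` this is `⟨H ⋆ Ψ, X⟩ = ⟨H, moyalForm Ψ X⟩`. -/
def starOp {ħ : ℝ} (hħ : 0 < ħ) (H : 𝓢'(Phase n, ℂ)) :
    𝓢(Phase n, ℂ) →ₗ[ℂ] 𝓢'(Phase n, ℂ) where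
  toFun Ψ := PointwiseConvergenceCLM.precomp ℂ (moyalForm hħ Ψ) H
  map_add' Ψ Ψ' := by
    ext X
    change H (moyalForm hħ (Ψ + Ψ') X) = H (moyalForm hħ Ψ X) + H (moyalForm hħ Ψ' X)
    rw [map_add, add_apply, map_add]
  map_smul' a Ψ := by
    ext X
    change H (moyalForm hħ (a • Ψ) X) = a • H (moyalForm hħ Ψ X)
    rw [map_smul, smul_apply, map_smul]

theorem starOp_apply {ħ : ℝ} (hħ : 0 < ħ) (H : 𝓢'(Phase n, ℂ)) (Ψ X : 𝓢(Phase n, ℂ)) :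
    starOp hħ H Ψ X = H (moyalForm hħ Ψ X) := rfl

theorem integral_norm_sq_partialFourier {ħ : ℝ} (hħ : 0 < ħ) (F : 𝓢(Phase n, ℂ))
    (x : Config n) :
    ∫ p, ‖partialFourier (inv_ne_zero hħ.ne') F (x, p)‖ ^ 2 =
      (2 * Real.pi * ħ) ^ n * ∫ y, ‖F (x, y)‖ ^ 2 := by
  have h0 : 0 < 2 * Real.pi * ħ := by positivity
  have h1 : ∀ p, partialFourier (inv_ne_zero hħ.ne') F (x, p) =
      (FourierTransform.fourier (slice x F)) ((2 * Real.pi * ħ)⁻¹ • p) := by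
    intro p
    rw [partialFourier_apply, fourier_coe, Real.fourier_eq']
    refine integral_congr_ae (Filter.Eventually.of_forall fun y => ?_)
    simp only [slice_apply, smul_eq_mul, inner_smul_right]
    congr 2
    have hp : (Real.pi : ℂ) ≠ 0 := by exact_mod_cast Real.pi_ne_zero
    have hh : (ħ : ℂ) ≠ 0 := by exact_mod_cast hħ.ne'
    push_cast
    field_simp
  simp only [h1]
  rw [Measure.integral_comp_smul volume
    (fun q => ‖(FourierTransform.fourier (slice x F)) q‖ ^ 2) (2 * Real.pi * ħ)⁻¹,
    SchwartzMap.integral_norm_sq_fourier]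
  simp only [finrank_euclideanSpace, Fintype.card_fin, inv_pow, inv_inv, smul_eq_mul,
    abs_of_pos (pow_pos h0 n), slice_apply]

theorem integrable_norm_sq {A : Type} [NormedAddCommGroup A] [NormedSpace ℝ A]
    [MeasurableSpace A] [BorelSpace A] [SecondCountableTopology A] (μ : Measure A)
    [μ.HasTemperateGrowth] (f : 𝓢(A, ℂ)) : Integrable (fun x => ‖f x‖ ^ 2) μ :=
  (f.memLp 2 μ).integrable_norm_pow (by norm_num)

/-- Moyal's identity for the norms. -/
theorem integral_norm_sq_wignerTransform {ħ : ℝ} (hħ : 0 < ħ) (φ ψ : 𝓢(Config n, ℂ)) :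
    ∫ z, ‖wignerTransform hħ φ ψ z‖ ^ 2 = (∫ x, ‖φ x‖ ^ 2) * ∫ x, ‖ψ x‖ ^ 2 := by
  have h0 : 0 < 2 * Real.pi * ħ := by positivity
  set F : 𝓢(Phase n, ℂ) := pullback (midMap n) midMap_injective (tensor ψ (conjS φ)) with hF
  have hFa : ∀ x y, ‖F (x, y)‖ ^ 2 =
      ‖ψ (x + (1 / 2 : ℝ) • y)‖ ^ 2 * ‖φ (x - (1 / 2 : ℝ) • y)‖ ^ 2 := by
    intro x y
    have : F (x, y) = ψ (x + (1 / 2 : ℝ) • y) *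
      starRingEnd ℂ (φ (x - (1 / 2 : ℝ) • y)) := rfl
    rw [this, norm_mul, RCLike.norm_conj, mul_pow]
  have hW : ∀ z, ‖wignerTransform hħ φ ψ z‖ ^ 2 =
      ((2 * Real.pi * ħ) ^ n)⁻¹ * ‖partialFourier (inv_ne_zero hħ.ne') F z‖ ^ 2 := by
    intro z
    have e : wignerTransform hħ φ ψ z = (((2 * Real.pi * ħ) ^ (-((n : ℝ) / 2)) : ℝ) : ℂ) *
      partialFourier (inv_ne_zero hħ.ne') F z := wignerTransform_apply hħ φ ψ z
    rw [e, norm_mul, mul_pow, Complex.norm_real, Real.norm_eq_abs, sq_abs, ← Real.rpow_natCast,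
      ← Real.rpow_mul h0.le, ← Real.rpow_natCast _ n, ← Real.rpow_neg h0.le]
    congr 2
    push_cast
    ring
  have hFi : Integrable (fun z : Phase n => ‖F z‖ ^ 2) := integrable_norm_sq volume F
  rw [integral_phase _ (integrable_norm_sq volume _)]
  simp only [hW, integral_const_mul, integral_norm_sq_partialFourier hħ F]
  rw [← mul_assoc, inv_mul_cancel₀ (pow_pos h0 n).ne', one_mul]
  have hsw : (∫ x, ∫ y, ‖F (x, y)‖ ^ 2) = ∫ y, ∫ x, ‖F (x, y)‖ ^ 2 :=
    integral_integral_swap (f := fun x y => ‖F (x, y)‖ ^ 2) hFi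
  rw [hsw]
  simp only [hFa]
  have ht : ∀ y : Config n, (∫ x, ‖ψ (x + (1 / 2 : ℝ) • y)‖ ^ 2 *
      ‖φ (x - (1 / 2 : ℝ) • y)‖ ^ 2) = ∫ x, ‖ψ x‖ ^ 2 * ‖φ (x - y)‖ ^ 2 := by
    intro y
    rw [← integral_add_right_eq_self (fun x => ‖ψ x‖ ^ 2 * ‖φ (x - y)‖ ^ 2) ((1 / 2 : ℝ) • y)]
    congr 1
    ext x
    congr 4
    module
  simp only [ht]
  have hG : Integrable (fun z : Config n × Config n => ‖ψ z.2‖ ^ 2 * ‖φ (z.2 - z.1)‖ ^ 2)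
      (volume.prod volume) := by
    set L : Phase n →L[ℝ] Phase n := ContinuousLinearMap.prod
      (ContinuousLinearMap.snd ℝ _ _)
      (ContinuousLinearMap.snd ℝ _ _ - ContinuousLinearMap.fst ℝ _ _) with hL
    have hLi : Function.Injective L := by
      rintro ⟨a, b⟩ ⟨a', b'⟩ h
      have h1 : b = b' := congrArg Prod.fst h
      have h2 : b - a = b' - a' := congrArg Prod.snd h
      subst h1
      rw [sub_right_injective h2]
    have := integrable_norm_sq (volume : Measure (Phase n)) (pullback L hLi (tensor ψ φ))
    refine this.congr (Filter.Eventually.of_forall fun z => ?_)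
    have e : pullback L hLi (tensor ψ φ) z = ψ z.2 * φ (z.2 - z.1) := rfl
    simp only [e, norm_mul, mul_pow]
  rw [integral_integral_swap (f := fun y x => ‖ψ x‖ ^ 2 * ‖φ (x - y)‖ ^ 2) hG]
  simp only [integral_const_mul]
  have hs : ∀ x : Config n, (∫ y, ‖φ (x - y)‖ ^ 2) = ∫ y, ‖φ y‖ ^ 2 := fun x =>
    integral_sub_left_eq_self (fun y => ‖φ y‖ ^ 2) volume x
  simp only [hs, integral_mul_const]
  ring

/-- The Hilbert space `L²(V)` with respect to Lebesgue measure. -/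
abbrev L2 (V : Type) [MeasureSpace V] : Type := Lp ℂ 2 (volume : Measure V)

theorem norm_wignerTransform {ħ : ℝ} (hħ : 0 < ħ) (φ ψ : 𝓢(Config n, ℂ)) :
    ‖(wignerTransform hħ φ ψ).toLp 2‖ = ‖φ.toLp 2‖ * ‖ψ.toLp 2‖ := by
  have h : ∀ {A : Type} [NormedAddCommGroup A] [NormedSpace ℝ A] [MeasurableSpace A]
      [BorelSpace A] [SecondCountableTopology A] (μ : Measure A) [μ.HasTemperateGrowth]
      (f : 𝓢(A, ℂ)), ‖f.toLp 2 μ‖ = Real.sqrt (∫ x, ‖f x‖ ^ 2 ∂μ) := by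
    intro A _ _ _ _ _ μ _ f
    rw [norm_toLp' (by norm_num) (by norm_num), Real.sqrt_eq_rpow]
    norm_num
  rw [h, h, h, integral_norm_sq_wignerTransform, Real.sqrt_mul (integral_nonneg fun _ => by positivity)]

/-- The embedding of the Schwartz space into `L²`. -/
def toL2 {V : Type} [NormedAddCommGroup V] [NormedSpace ℝ V] [MeasureSpace V] [BorelSpace V]
    [SecondCountableTopology V] [(volume : Measure V).HasTemperateGrowth] :
    𝓢(V, ℂ) →ₗ[ℂ] L2 V :=
  (toLpCLM ℂ ℂ 2 (volume : Measure V)).toLinearMap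

theorem toL2_apply {V : Type} [NormedAddCommGroup V] [NormedSpace ℝ V] [MeasureSpace V]
    [BorelSpace V] [SecondCountableTopology V] [(volume : Measure V).HasTemperateGrowth]
    (f : 𝓢(V, ℂ)) : toL2 f = f.toLp 2 := rfl

/-- The bounded operator `W_φ : L²(ℝⁿ) → L²(ℝ²ⁿ)` that extends `wignerTransform hħ φ` by
continuity; it is an isometry if `φ` has norm one. -/
def wignerL2 {ħ : ℝ} (hħ : 0 < ħ) (φ : 𝓢(Config n, ℂ)) : L2 (Config n) →L[ℂ] L2 (Phase n) :=
  (toL2 ∘ₗ wignerTransform hħ φ).extendOfNorm toL2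

theorem wignerL2_toLp {ħ : ℝ} (hħ : 0 < ħ) (φ ψ : 𝓢(Config n, ℂ)) :
    wignerL2 hħ φ (ψ.toLp 2) = (wignerTransform hħ φ ψ).toLp 2 := by
  have hb : ∃ C : ℝ, ∀ x, ‖(toL2 ∘ₗ wignerTransform hħ φ) x‖ ≤
      C * ‖toL2 (V := Config n) x‖ := by
    refine ⟨‖φ.toLp 2‖, fun ψ => ?_⟩
    rw [LinearMap.comp_apply, toL2_apply, toL2_apply]
    exact (norm_wignerTransform hħ φ ψ).le
  have hd : DenseRange (toL2 (V := Config n)) :=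
    denseRange_toLpCLM (F := ℂ) (p := 2) (μ := (volume : Measure (Config n)))
      ENNReal.ofNat_ne_top
  have h := LinearMap.extendOfNorm_eq hd hb ψ
  rw [LinearMap.comp_apply, toL2_apply, toL2_apply] at h
  exact h

section Realizations

variable {V : Type} [NormedAddCommGroup V] [NormedSpace ℝ V] [MeasureSpace V] [BorelSpace V]
  [SecondCountableTopology V] [(volume : Measure V).HasTemperateGrowth]

/-- The graph of `A` restricted to those Schwartz functions that `A` maps into `L²`: all pairs
`(ψ, f)` with `ψ` a Schwartz function, `f ∈ L²` and `A ψ = f` as tempered distributions. -/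
def schwartzGraph (A : 𝓢(V, ℂ) →ₗ[ℂ] 𝓢'(V, ℂ)) : Set (L2 V × L2 V) :=
  {q | ∃ ψ : 𝓢(V, ℂ), ψ.toLp 2 = q.1 ∧ A ψ = Lp.toTemperedDistribution q.2}

/-- The graph of the formal adjoint of `A`: all pairs `(χ, g)` with `χ` a Schwartz function,
`g ∈ L²` and `⟨A θ, conj χ⟩ = (g, θ)` for all Schwartz functions `θ`, where the inner product is
conjugate-linear in the first entry. -/
def formalAdjointGraph (A : 𝓢(V, ℂ) →ₗ[ℂ] 𝓢'(V, ℂ)) : Set (L2 V × L2 V) :=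
  {q | ∃ χ : 𝓢(V, ℂ), χ.toLp 2 = q.1 ∧
    ∀ θ : 𝓢(V, ℂ), A θ (conjS χ) = inner ℂ q.2 (θ.toLp 2)}

/-- The graph of the maximal (weak) realization of `A` in `L²`: all pairs `(ψ, f)` such that
`A ψ = f` holds weakly, that is `(g, ψ) = (χ, f)` whenever `g ∈ L²` is the image of the Schwartz
function `χ` under the formal adjoint of `A`. -/
def maximalGraph (A : 𝓢(V, ℂ) →ₗ[ℂ] 𝓢'(V, ℂ)) : Set (L2 V × L2 V) :=
  {q | ∀ r ∈ formalAdjointGraph A, inner ℂ r.2 q.1 = inner ℂ r.1 q.2}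

/-- Three ways to read an operator `𝓢(V) → 𝓢'(V)` as an operator in `L²(V)`: on Schwartz functions
only, by taking the closure of the graph, or by maximal (weak) extension. -/
inductive Realization : Type
  | onSchwartz
  | closure
  | maximal

/-- The graph in `L² × L²` of the given realization of `A`. -/
def Realization.graph (A : 𝓢(V, ℂ) →ₗ[ℂ] 𝓢'(V, ℂ)) : Realization → Set (L2 V × L2 V)
  | .onSchwartz => schwartzGraph A
  | .closure => _root_.closure (schwartzGraph A)
  | .maximal => maximalGraph A

/-- `ψ` is an eigenfunction with eigenvalue `μ` of the operator with graph `Γ`. -/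
def IsEigenfunction (Γ : Set (L2 V × L2 V)) (μ : ℂ) (ψ : L2 V) : Prop :=
  ψ ≠ 0 ∧ (ψ, μ • ψ) ∈ Γ

/-- The set of eigenvalues of the operator with graph `Γ`. -/
def eigenvalues (Γ : Set (L2 V × L2 V)) : Set ℂ := {μ | ∃ ψ, IsEigenfunction Γ μ ψ}

end Realizations

end PhaseSpace

end

/-!
The Wigner transforms `W_φ` intertwine the Weyl operator with the star operator already at the
level of the test functions against which the symbol `H` is paired. Write `W_φᵀ` for the transpose
of `W_φ` on Schwartz functions (`wignerTranspose`) and `W_φ^* X = conj (W_φᵀ (conj X))`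
(`wignerAdjoint`). Then

* `moyalForm (W_φ ψ) X = wignerForm ψ (W_φᵀ X)` (`moyalForm_wignerTransform`),
* `moyalForm Ψ (conj (W_φ χ)) = wignerForm (W_φ^* Ψ) (conj χ)` (`moyalForm_conj_wignerTransform`).

For the first identity, evaluate both sides at a point `w`, that is, take a point mass at `w` as
symbol. The Weyl operator is then a multiple of the phase space reflection `R_w`
(`wignerForm_eq_reflection`), and Fourier inversion in the momentum variable shows that the star
operator maps `W_φ ψ` to a multiple of `W_φ (R_w ψ)` (`integral_moyal_wignerTransform`). The second
identity follows from the first because both forms are Hermitian (`conj_wignerForm`,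
`conj_moyalForm`).

Pairing with `H`, the first identity shows that `W_φ` maps the graph of `Ĥ` on Schwartz functions
into that of `H ⋆`, and that `W_φ^*` maps the graph of the formal adjoint of `H ⋆` into that of
`Ĥ`; the second identity gives the same with the roles of the two operators exchanged. As `W_φ` and
`W_φ^*` are bounded and `W_φ^*` is the Hilbert space adjoint (`adjoint_wignerL2_toLp`), all three
realizations are intertwined in both directions (`mem_graph_starOp`, `mem_graph_weylOp`).

Eigenfunctions are preserved by `W_φ` because it is isometric for `‖φ‖ = 1` (`norm_wignerL2`). That
some `W_φ^* Ψ` is nonzero when `Ψ ≠ 0` is the completeness of the functions `W_φ ψ`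
(`eq_zero_of_inner_wignerTransform_eq_zero`): they are the images of the tensor products
`ψ ⊗ conj φ` under a unitary operator, and tensor products are complete by Lebesgue differentiation
over balls of phase space, which are products of balls.
-/

namespace PhaseSpace

variable {n : ℕ} {ħ : ℝ}

/-! ### Partial Fourier inversion and self-duality -/

theorem partialFourier_eq_fourier_slice (hħ : 0 < ħ) (F : 𝓢(Phase n, ℂ)) (x p : Config n) :
    partialFourier (inv_ne_zero hħ.ne') F (x, p) =
      (FourierTransform.fourier (slice x F)) ((2 * Real.pi * ħ)⁻¹ • p) := by
  rw [partialFourier_apply, fourier_coe, Real.fourier_eq']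
  refine integral_congr_ae (Filter.Eventually.of_forall fun y => ?_)
  simp only [slice_apply, smul_eq_mul, inner_smul_right]
  congr 2
  have hp : (Real.pi : ℂ) ≠ 0 := by exact_mod_cast Real.pi_ne_zero
  have hh : (ħ : ℂ) ≠ 0 := by exact_mod_cast hħ.ne'
  push_cast
  field_simp

/-- Applying the partial Fourier transform twice reflects the second variable. -/
theorem partialFourier_partialFourier (hħ : 0 < ħ) (F : 𝓢(Phase n, ℂ)) (x y : Config n) :
    partialFourier (inv_ne_zero hħ.ne') (partialFourier (inv_ne_zero hħ.ne') F) (x, y) =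
      ((2 * Real.pi * ħ) ^ n : ℝ) * F (x, -y) := by
  have h0 : 0 < 2 * Real.pi * ħ := by positivity
  have hinv : F (x, -y) = ∫ q, Complex.exp ((-2 * Real.pi * ⟪q, y⟫ : ℝ) * Complex.I) *
      (FourierTransform.fourier (slice x F)) q := by
    have h1 : FourierTransform.fourierInv (FourierTransform.fourier (slice x F)) = slice x F :=
      FourierTransform.fourierInv_fourier_eq _
    have h2 := congrArg (fun f : 𝓢(Config n, ℂ) => f (-y)) h1
    simp only [slice_apply] at h2
    rw [← h2, fourierInv_coe, Real.fourierInv_eq']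
    refine integral_congr_ae (Filter.Eventually.of_forall fun q => ?_)
    simp only [smul_eq_mul, inner_neg_right]
    congr 2
    push_cast
    ring
  rw [partialFourier_apply, hinv]
  simp only [partialFourier_eq_fourier_slice hħ]
  have h3 := Measure.integral_comp_smul (volume : Measure (Config n))
    (fun q => Complex.exp ((-2 * Real.pi * ⟪q, y⟫ : ℝ) * Complex.I) *
      (FourierTransform.fourier (slice x F)) q) (2 * Real.pi * ħ)⁻¹
  simp only [finrank_euclideanSpace, Fintype.card_fin, inv_pow, inv_inv,
    abs_of_pos (pow_pos h0 n), Complex.real_smul] at h3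
  rw [← h3]
  refine integral_congr_ae (Filter.Eventually.of_forall fun p => ?_)
  simp only [inner_smul_left, conj_trivial]
  congr 3
  have hp : Real.pi ≠ 0 := Real.pi_ne_zero
  have hh : ħ ≠ 0 := hħ.ne'
  rw [← Complex.ofReal_neg]
  congr 1
  field_simp

/-- The pointwise product of two Schwartz functions. -/
noncomputable def mulS {A : Type} [NormedAddCommGroup A] [NormedSpace ℝ A] (f g : 𝓢(A, ℂ)) :
    𝓢(A, ℂ) := smulLeftCLM ℂ f g

theorem mulS_apply {A : Type} [NormedAddCommGroup A] [NormedSpace ℝ A] (f g : 𝓢(A, ℂ)) (a : A) :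
    mulS f g a = f a * g a :=
  smulLeftCLM_apply_apply f.hasTemperateGrowth g a

theorem integral_phase_eq (F : 𝓢(Phase n, ℂ)) : ∫ z, F z = ∫ x, ∫ y, F (x, y) :=
  integral_phase _ F.integrable

theorem integral_phase_eq_swap (F : 𝓢(Phase n, ℂ)) : ∫ z, F z = ∫ y, ∫ x, F (x, y) := by
  rw [integral_phase_eq]
  exact integral_integral_swap (f := fun x y => F (x, y)) (F.integrable (μ := volume))

theorem integral_partialFourier_mul (hħ : 0 < ħ) (F X : 𝓢(Phase n, ℂ)) :
    ∫ z, partialFourier (inv_ne_zero hħ.ne') F z * X z =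
      ∫ z, F z * partialFourier (inv_ne_zero hħ.ne') X z := by
  simp only [← mulS_apply]
  rw [integral_phase_eq, integral_phase_eq]
  refine integral_congr_ae (Filter.Eventually.of_forall fun x => ?_)
  simp only [mulS_apply, partialFourier_apply]
  have h := VectorFourier.integral_fourierIntegral_smul_eq_flip (μ := (volume : Measure (Config n)))
    (ν := (volume : Measure (Config n))) (e := Real.fourierChar) (f := slice x F) (g := slice x X)
    (L := (2 * Real.pi * ħ)⁻¹ • innerₗ (Config n)) Real.continuous_fourierChar
    (by simp only [LinearMap.smul_apply, innerₗ_apply_apply]; fun_prop)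
    (slice x F).integrable (slice x X).integrable
  have hp : (Real.pi : ℂ) ≠ 0 := by exact_mod_cast Real.pi_ne_zero
  have hh : (ħ : ℂ) ≠ 0 := by exact_mod_cast hħ.ne'
  simp only [VectorFourier.fourierIntegral, smul_eq_mul, slice_apply, Circle.smul_def,
    Real.fourierChar_apply, LinearMap.flip_apply, LinearMap.smul_apply, innerₗ_apply_apply] at h
  convert! h using 1
  · refine integral_congr_ae (Filter.Eventually.of_forall fun p => ?_)
    simp only
    congr 1
    refine integral_congr_ae (Filter.Eventually.of_forall fun y => ?_)
    simp only
    congr 2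
    push_cast
    field_simp
  · refine integral_congr_ae (Filter.Eventually.of_forall fun p => ?_)
    simp only
    congr 1
    refine integral_congr_ae (Filter.Eventually.of_forall fun y => ?_)
    simp only
    rw [real_inner_comm]
    congr 2
    push_cast
    field_simp

/-! ### The phase space transform and its transpose -/

/-- The inverse `(s, t) ↦ ((s + t)/2, s - t)` of `midMap`. -/
noncomputable def unmidMap (n : ℕ) : Phase n →L[ℝ] Phase n :=
  ContinuousLinearMap.prod
    ((1 / 2 : ℝ) • (ContinuousLinearMap.fst ℝ _ _ + ContinuousLinearMap.snd ℝ _ _))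
    (ContinuousLinearMap.fst ℝ _ _ - ContinuousLinearMap.snd ℝ _ _)

theorem unmidMap_midMap (z : Phase n) : unmidMap n (midMap n z) = z := by
  obtain ⟨x, y⟩ := z
  refine Prod.ext ?_ ?_
  · change (1 / 2 : ℝ) • ((x + (1 / 2 : ℝ) • y) + (x - (1 / 2 : ℝ) • y)) = x
    module
  · change (x + (1 / 2 : ℝ) • y) - (x - (1 / 2 : ℝ) • y) = y
    module

theorem midMap_unmidMap (z : Phase n) : midMap n (unmidMap n z) = z := by
  obtain ⟨s, t⟩ := z
  refine Prod.ext ?_ ?_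
  · change (1 / 2 : ℝ) • (s + t) + (1 / 2 : ℝ) • (s - t) = s
    module
  · change (1 / 2 : ℝ) • (s + t) - (1 / 2 : ℝ) • (s - t) = t
    module

theorem unmidMap_injective : Function.Injective (unmidMap n) :=
  Function.LeftInverse.injective midMap_unmidMap

/-- The map `midMap` preserves Lebesgue measure: it is a composition of shears and a reflection. -/
theorem integral_pullback_midMap (F : 𝓢(Phase n, ℂ)) :
    ∫ z, pullback (midMap n) midMap_injective F z = ∫ z, F z := by
  set L : Phase n →L[ℝ] Phase n := ContinuousLinearMap.prod (ContinuousLinearMap.fst ℝ _ _)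
    (ContinuousLinearMap.fst ℝ _ _ - ContinuousLinearMap.snd ℝ _ _) with hL
  have hLi : Function.Injective L := by
    rintro ⟨a, b⟩ ⟨a', b'⟩ h
    have h1 : a = a' := congrArg Prod.fst h
    have h2 : a - b = a' - b' := congrArg Prod.snd h
    subst h1
    rw [sub_right_injective h2]
  calc ∫ z, pullback (midMap n) midMap_injective F z
      = ∫ y, ∫ x, F (x + (1 / 2 : ℝ) • y, x - (1 / 2 : ℝ) • y) := integral_phase_eq_swap _
    _ = ∫ y, ∫ x, F (x, x - y) := by
        refine integral_congr_ae (Filter.Eventually.of_forall fun y => ?_)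
        simp only
        rw [← integral_add_right_eq_self (fun x => F (x, x - y)) ((1 / 2 : ℝ) • y)]
        congr 1
        ext x
        congr 2
        module
    _ = ∫ z, pullback L hLi F z := (integral_phase_eq_swap (pullback L hLi F)).symm
    _ = ∫ x, ∫ y, F (x, x - y) := integral_phase_eq _
    _ = ∫ x, ∫ y, F (x, y) := by
        refine integral_congr_ae (Filter.Eventually.of_forall fun x => ?_)
        exact integral_sub_left_eq_self (fun y => F (x, y)) volume x
    _ = ∫ z, F z := (integral_phase_eq F).symm

/-- The linear extension `ψ ⊗ conj φ ↦ W_φ ψ` of the Wigner transforms to all Schwartz functions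
of two variables. -/
noncomputable def phaseTransform (hħ : 0 < ħ) : 𝓢(Phase n, ℂ) →L[ℂ] 𝓢(Phase n, ℂ) :=
  (((2 * Real.pi * ħ) ^ (-((n : ℝ) / 2)) : ℝ) : ℂ) • (partialFourier (inv_ne_zero hħ.ne')).comp
    (pullback (midMap n) midMap_injective)

theorem phaseTransform_tensor (hħ : 0 < ħ) (φ ψ : 𝓢(Config n, ℂ)) :
    phaseTransform hħ (tensor ψ (conjS φ)) = wignerTransform hħ φ ψ := by
  ext z
  rw [wignerTransform_apply]
  rfl

theorem phaseTransform_apply (hħ : 0 < ħ) (F : 𝓢(Phase n, ℂ)) (z : Phase n) :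
    phaseTransform hħ F z = (((2 * Real.pi * ħ) ^ (-((n : ℝ) / 2)) : ℝ) : ℂ) *
      partialFourier (inv_ne_zero hħ.ne') (pullback (midMap n) midMap_injective F) z := rfl

/-- The transpose of `phaseTransform` for the bilinear pairing `∫ F G`. -/
noncomputable def phaseTranspose (hħ : 0 < ħ) : 𝓢(Phase n, ℂ) →L[ℂ] 𝓢(Phase n, ℂ) :=
  (((2 * Real.pi * ħ) ^ (-((n : ℝ) / 2)) : ℝ) : ℂ) •
    (pullback (unmidMap n) unmidMap_injective).comp (partialFourier (inv_ne_zero hħ.ne'))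

theorem phaseTranspose_apply (hħ : 0 < ħ) (F : 𝓢(Phase n, ℂ)) (z : Phase n) :
    phaseTranspose hħ F z = (((2 * Real.pi * ħ) ^ (-((n : ℝ) / 2)) : ℝ) : ℂ) *
      partialFourier (inv_ne_zero hħ.ne') F (unmidMap n z) := rfl

theorem integral_phaseTransform_mul (hħ : 0 < ħ) (F X : 𝓢(Phase n, ℂ)) :
    ∫ z, phaseTransform hħ F z * X z = ∫ z, F z * phaseTranspose hħ X z := by
  rw [← integral_congr_ae (Filter.Eventually.of_forall fun z => mulS_apply F _ z),
    ← integral_pullback_midMap]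
  simp only [phaseTransform_apply, pullback_apply, mulS_apply, phaseTranspose_apply,
    unmidMap_midMap]
  generalize (((2 * Real.pi * ħ) ^ (-((n : ℝ) / 2)) : ℝ) : ℂ) = c
  simp only [mul_assoc, mul_left_comm _ c]
  rw [integral_const_mul, integral_const_mul, integral_partialFourier_mul hħ]
  rfl

/-- Surjectivity comes from Fourier inversion in the second variable. -/
theorem phaseTransform_surjective (hħ : 0 < ħ) :
    Function.Surjective (phaseTransform (n := n) hħ) := by
  intro G
  have h0 : 0 < 2 * Real.pi * ħ := by positivity
  have hs : ((2 * Real.pi * ħ) ^ (-((n : ℝ) / 2)) : ℝ) ≠ 0 := (Real.rpow_pos_of_pos h0 _).ne'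
  set ρ : Phase n →L[ℝ] Phase n := ContinuousLinearMap.prod (ContinuousLinearMap.fst ℝ _ _)
    (-ContinuousLinearMap.snd ℝ _ _) with hρ
  have hρi : Function.Injective ρ := by
    rintro ⟨a, b⟩ ⟨a', b'⟩ h
    have h1 : a = a' := congrArg Prod.fst h
    have h2 : -b = -b' := congrArg Prod.snd h
    rw [h1, neg_injective h2]
  -- Up to a scalar, the inverse of the partial Fourier transform is its composition with a
  -- reflection.
  refine ⟨((((2 * Real.pi * ħ) ^ (-((n : ℝ) / 2)) : ℝ) : ℂ) *
    ((2 * Real.pi * ħ) ^ n : ℝ))⁻¹ • pullback (unmidMap n) unmidMap_injective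
      (partialFourier (inv_ne_zero hħ.ne') (pullback ρ hρi G)), ?_⟩
  ext z
  obtain ⟨x, p⟩ := z
  rw [map_smul, smul_apply, phaseTransform_apply]
  have e : pullback (midMap n) midMap_injective (pullback (unmidMap n) unmidMap_injective
      (partialFourier (inv_ne_zero hħ.ne') (pullback ρ hρi G))) =
      partialFourier (inv_ne_zero hħ.ne') (pullback ρ hρi G) := by
    ext z
    rw [pullback_apply, pullback_apply, unmidMap_midMap]
  rw [e, partialFourier_partialFourier hħ, pullback_apply, smul_eq_mul]
  have e2 : ρ (x, -p) = (x, p) := Prod.ext rfl (neg_neg p)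
  have hs' : (((2 * Real.pi * ħ) ^ (-((n : ℝ) / 2)) : ℝ) : ℂ) ≠ 0 := Complex.ofReal_ne_zero.2 hs
  have hn : (((2 * Real.pi * ħ) ^ n : ℝ) : ℂ) ≠ 0 := Complex.ofReal_ne_zero.2 (pow_pos h0 n).ne'
  rw [e2, ← mul_assoc, ← mul_assoc, mul_assoc _ _ (((2 * Real.pi * ħ) ^ n : ℝ) : ℂ),
    inv_mul_cancel₀ (mul_ne_zero hs' hn), one_mul]

/-- The transpose of `W_φ` for the bilinear pairings:
`∫ conj φ(t) (phaseTranspose X)(s, t) dt`. -/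
noncomputable def wignerTranspose (hħ : 0 < ħ) (φ : 𝓢(Config n, ℂ)) (X : 𝓢(Phase n, ℂ)) :
    𝓢(Config n, ℂ) :=
  integrateOut (smulLeftCLM ℂ (fun z : Phase n => conjS φ z.2) (phaseTranspose hħ X))

theorem wignerTranspose_apply (hħ : 0 < ħ) (φ : 𝓢(Config n, ℂ)) (X : 𝓢(Phase n, ℂ))
    (s : Config n) :
    wignerTranspose hħ φ X s = ∫ t, conjS φ t * phaseTranspose hħ X (s, t) := by
  have h : (fun z : Phase n => conjS φ z.2).HasTemperateGrowth :=
    (conjS φ).hasTemperateGrowth.comp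
      (ContinuousLinearMap.snd ℝ (Config n) (Config n)).hasTemperateGrowth
  rw [wignerTranspose, integrateOut_apply]
  simp only [smulLeftCLM_apply_apply h, smul_eq_mul]

theorem integral_wignerTransform_mul (hħ : 0 < ħ) (φ ψ : 𝓢(Config n, ℂ)) (X : 𝓢(Phase n, ℂ)) :
    ∫ z, wignerTransform hħ φ ψ z * X z = ∫ x, ψ x * wignerTranspose hħ φ X x := by
  rw [← phaseTransform_tensor, integral_phaseTransform_mul]
  rw [← integral_congr_ae (Filter.Eventually.of_forall fun z => mulS_apply (tensor ψ (conjS φ)) _ z),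
    integral_phase_eq]
  simp only [mulS_apply, tensor_apply, wignerTranspose_apply, ← integral_const_mul, mul_assoc]

/-- The restriction to Schwartz functions of the Hilbert space adjoint of `W_φ`. -/
noncomputable def wignerAdjoint (hħ : 0 < ħ) (φ : 𝓢(Config n, ℂ)) (X : 𝓢(Phase n, ℂ)) :
    𝓢(Config n, ℂ) :=
  conjS (wignerTranspose hħ φ (conjS X))

/-! ### Phase space reflections and the intertwining relation -/

theorem iteratedDeriv_osc (κ : ℝ) (k : ℕ) :
    iteratedDeriv k (PartialFourier.osc κ) =
      fun t => (-(κ : ℂ) * Complex.I) ^ k * PartialFourier.osc κ t := by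
  induction k with
  | zero => simp
  | succ k ih =>
    rw [iteratedDeriv_succ, ih]
    ext t
    rw [((PartialFourier.hasDerivAt_osc κ t).const_mul _).deriv, pow_succ, mul_assoc (_ ^ k)]

theorem hasTemperateGrowth_osc (κ : ℝ) : (PartialFourier.osc κ).HasTemperateGrowth := by
  refine ⟨?_, fun k => ⟨0, |κ| ^ k, fun t => ?_⟩⟩
  · unfold PartialFourier.osc
    exact Complex.contDiff_exp.comp (ContDiff.mul (ContDiff.neg
      (Complex.ofRealCLM.contDiff.comp (contDiff_const.mul contDiff_id))) contDiff_const)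
  · rw [norm_iteratedFDeriv_eq_norm_iteratedDeriv, iteratedDeriv_osc]
    simp [PartialFourier.norm_osc]

/-- The phase space reflection at `w = (x₀, p₀)`:
`(R_w ψ)(x) = exp(2i (x - x₀)·p₀/ħ) ψ(2x₀ - x)`. -/
noncomputable def reflection (ħ : ℝ) (w : Phase n) (ψ : 𝓢(Config n, ℂ)) : 𝓢(Config n, ℂ) :=
  smulLeftCLM ℂ (fun x : Config n => PartialFourier.osc (-(2 * ħ⁻¹)) ⟪x - w.1, w.2⟫)
    (compCLMOfAntilipschitz ℂ (g := fun x : Config n => (2 : ℝ) • w.1 - x) (K := 1)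
      ((Function.HasTemperateGrowth.const _).sub .id')
      (AntilipschitzWith.of_le_mul_dist fun a b => by rw [dist_sub_left]; simp) ψ)

theorem reflection_apply (w : Phase n) (ψ : 𝓢(Config n, ℂ)) (x : Config n) :
    reflection ħ w ψ x = Complex.exp (((2 * ħ⁻¹ * ⟪x - w.1, w.2⟫ : ℝ) : ℂ) * Complex.I) *
      ψ ((2 : ℝ) • w.1 - x) := by
  have h : (fun x : Config n =>
      PartialFourier.osc (-(2 * ħ⁻¹)) ⟪x - w.1, w.2⟫).HasTemperateGrowth := by
    have h1 : (fun x : Config n => (⟪x - w.1, w.2⟫ : ℝ)).HasTemperateGrowth :=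
      (Function.hasTemperateGrowth_inner_left w.2).comp
        (Function.HasTemperateGrowth.id'.sub (.const w.1))
    exact (hasTemperateGrowth_osc _).comp h1
  rw [reflection, smulLeftCLM_apply_apply h]
  simp only [smul_eq_mul, PartialFourier.osc, compCLMOfAntilipschitz_apply, Function.comp_apply]
  congr 2
  push_cast
  ring

/-- The Weyl transform of a point mass is a multiple of the phase space reflection. -/
theorem wignerForm_eq_reflection (hħ : 0 < ħ) (ψ χ : 𝓢(Config n, ℂ)) (w : Phase n) :
    wignerForm hħ ψ χ w = ((((2 * Real.pi * ħ) ^ n : ℝ) : ℂ)⁻¹ * 2 ^ n) *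
      ∫ x, reflection ħ w ψ x * χ x := by
  rw [wignerForm_apply]
  generalize (((2 * Real.pi * ħ) ^ n : ℝ) : ℂ)⁻¹ = c
  rw [mul_assoc]
  congr 1
  have h := Measure.integral_comp_smul (volume : Measure (Config n))
    (fun x => reflection ħ w ψ (w.1 - x) * χ (w.1 - x)) (1 / 2 : ℝ)
  rw [integral_sub_left_eq_self (fun x => reflection ħ w ψ x * χ x)] at h
  have h2 : |((1 / 2 : ℝ) ^ n)⁻¹| = 2 ^ n := by
    rw [one_div, inv_pow, inv_inv, abs_of_pos (by positivity)]
  simp only [finrank_euclideanSpace, Fintype.card_fin, Complex.real_smul, h2] at h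
  push_cast at h
  rw [← h]
  refine integral_congr_ae (Filter.Eventually.of_forall fun y => ?_)
  simp only [reflection_apply]
  rw [← mul_assoc]
  congr 3
  · simp only [sub_sub_cancel_left, inner_neg_left, inner_smul_left, conj_trivial]
    push_cast
    ring
  · module

/-- Fourier inversion in the momentum variable for `phaseTransform`. -/
theorem integral_exp_mul_phaseTransform (hħ : 0 < ħ) (F : 𝓢(Phase n, ℂ)) (x y : Config n) :
    ∫ q, Complex.exp (((ħ⁻¹ * ⟪q, y⟫ : ℝ) : ℂ) * Complex.I) * phaseTransform hħ F (x, q) =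
      ((2 * Real.pi * ħ) ^ n : ℝ) * ((((2 * Real.pi * ħ) ^ (-((n : ℝ) / 2)) : ℝ) : ℂ) *
        F (x + (1 / 2 : ℝ) • y, x - (1 / 2 : ℝ) • y)) := by
  have h := partialFourier_partialFourier hħ (pullback (midMap n) midMap_injective F) x (-y)
  rw [partialFourier_apply, neg_neg] at h
  have e : pullback (midMap n) midMap_injective F (x, y) =
    F (x + (1 / 2 : ℝ) • y, x - (1 / 2 : ℝ) • y) := rfl
  rw [e] at h
  simp only [phaseTransform_apply]
  rw [mul_left_comm, ← h, ← integral_const_mul]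
  refine integral_congr_ae (Filter.Eventually.of_forall fun q => ?_)
  simp only
  rw [mul_left_comm]
  congr 3
  simp only [inner_neg_right]
  push_cast
  ring

theorem integrable_moyal_inner (w z : Phase n) (Ψ : 𝓢(Phase n, ℂ)) :
    Integrable (fun v : Phase n => Complex.exp (((ħ⁻¹ * sympl (w - z) v : ℝ) : ℂ) * Complex.I) *
      Ψ (z - (1 / 2 : ℝ) • v)) := by
  have h1 : Integrable (fun v : Phase n => Ψ (z - (1 / 2 : ℝ) • v)) := by
    have := ((Ψ.integrable (μ := volume)).comp_add_left z).comp_smul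
      (by norm_num : (-(1 / 2) : ℝ) ≠ 0)
    simpa only [neg_smul, ← sub_eq_add_neg] using this
  refine h1.norm.mono' ?_ (Filter.Eventually.of_forall fun v => ?_)
  · refine Continuous.aestronglyMeasurable ?_
    have := Ψ.continuous
    unfold sympl
    fun_prop
  · rw [norm_mul, Complex.norm_exp_ofReal_mul_I, one_mul]

/-- Star multiplication by a point mass at `w` acts on `W_φ ψ` as the reflection at `w` acts
on `ψ`. -/
theorem integral_moyal_wignerTransform (hħ : 0 < ħ) (φ ψ : 𝓢(Config n, ℂ)) (w z : Phase n) :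
    ∫ v : Phase n, Complex.exp (((ħ⁻¹ * sympl (w - z) v : ℝ) : ℂ) * Complex.I) *
      wignerTransform hħ φ ψ (z - (1 / 2 : ℝ) • v) =
    (2 ^ n * (((2 * Real.pi * ħ) ^ n : ℝ) : ℂ)) *
      wignerTransform hħ φ (reflection ħ w ψ) z := by
  obtain ⟨x₀, p₀⟩ := w
  obtain ⟨x, p⟩ := z
  rw [integral_phase _ (integrable_moyal_inner _ _ _), wignerTransform_apply]
  have hin : ∀ a : Config n, (∫ b : Config n,
      Complex.exp (((ħ⁻¹ * sympl ((x₀, p₀) - (x, p)) (a, b) : ℝ) : ℂ) * Complex.I) *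
        wignerTransform hħ φ ψ ((x, p) - (1 / 2 : ℝ) • (a, b))) =
      2 ^ n * (((2 * Real.pi * ħ) ^ n : ℝ) * ((((2 * Real.pi * ħ) ^ (-((n : ℝ) / 2)) : ℝ) : ℂ) *
        (Complex.exp (((ħ⁻¹ * (⟪p₀ - p, a⟫ - 2 * ⟪p, x₀ - x⟫) : ℝ) : ℂ) * Complex.I) *
        (ψ (x₀ - (1 / 2 : ℝ) • a) *
          starRingEnd ℂ (φ ((2 : ℝ) • x - x₀ - (1 / 2 : ℝ) • a)))))) := by
    intro a
    have h1 := integral_exp_mul_phaseTransform hħ (tensor ψ (conjS φ))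
      (x - (1 / 2 : ℝ) • a) ((2 : ℝ) • (x₀ - x))
    rw [phaseTransform_tensor, tensor_apply, conjS_apply] at h1
    have e1 : x - (1 / 2 : ℝ) • a + (1 / 2 : ℝ) • (2 : ℝ) • (x₀ - x) = x₀ - (1 / 2 : ℝ) • a := by
      module
    have e2 : x - (1 / 2 : ℝ) • a - (1 / 2 : ℝ) • (2 : ℝ) • (x₀ - x) =
      (2 : ℝ) • x - x₀ - (1 / 2 : ℝ) • a := by module
    simp only [e1, e2] at h1
    -- Substitute `q = p - b/2` in the momentum integral.
    have h := Measure.integral_comp_smul (volume : Measure (Config n))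
      (fun b => Complex.exp (((ħ⁻¹ * ⟪p - b, (2 : ℝ) • (x₀ - x)⟫ : ℝ) : ℂ) * Complex.I) *
        wignerTransform hħ φ ψ (x - (1 / 2 : ℝ) • a, p - b)) (1 / 2 : ℝ)
    rw [integral_sub_left_eq_self (fun q =>
      Complex.exp (((ħ⁻¹ * ⟪q, (2 : ℝ) • (x₀ - x)⟫ : ℝ) : ℂ) * Complex.I) *
        wignerTransform hħ φ ψ (x - (1 / 2 : ℝ) • a, q)), h1] at h
    have h2 : |((1 / 2 : ℝ) ^ n)⁻¹| = 2 ^ n := by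
      rw [one_div, inv_pow, inv_inv, abs_of_pos (by positivity)]
    simp only [finrank_euclideanSpace, Fintype.card_fin, Complex.real_smul, h2] at h
    rw [mul_left_comm _ (Complex.exp _), mul_left_comm _ (Complex.exp _),
      mul_left_comm _ (Complex.exp _)]
    push_cast at h ⊢
    rw [← h, ← integral_const_mul]
    refine integral_congr_ae (Filter.Eventually.of_forall fun b => ?_)
    simp only
    rw [← mul_assoc, ← Complex.exp_add]
    congr 2
    simp only [sympl, Prod.fst_sub, Prod.snd_sub, inner_sub_left, inner_sub_right,
      inner_smul_right, inner_smul_left, conj_trivial]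
    push_cast
    ring
  simp only [hin]
  generalize (((2 * Real.pi * ħ) ^ n : ℝ) : ℂ) = c
  rw [integral_const_mul, integral_const_mul, integral_const_mul, mul_assoc (2 ^ n) c]
  congr 3
  -- Substitute `y = a + 2(x₀ - x)` in the position integral.
  symm
  refine (integral_add_right_eq_self _ ((2 : ℝ) • (x₀ - x))).symm.trans ?_
  refine integral_congr_ae (Filter.Eventually.of_forall fun a => ?_)
  have e1 : (2 : ℝ) • x₀ - (x + (1 / 2 : ℝ) • (a + (2 : ℝ) • (x₀ - x))) =
    x₀ - (1 / 2 : ℝ) • a := by module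
  have e2 : x - (1 / 2 : ℝ) • (a + (2 : ℝ) • (x₀ - x)) =
    (2 : ℝ) • x - x₀ - (1 / 2 : ℝ) • a := by module
  simp only [reflection_apply, e1, e2]
  rw [mul_assoc (Complex.exp _), ← mul_assoc (Complex.exp _) (Complex.exp _), ← Complex.exp_add]
  congr 2
  simp only [inner_sub_left, inner_sub_right, inner_add_left, inner_smul_left, conj_trivial,
    real_inner_comm a p₀, real_inner_comm a p, real_inner_comm x₀ p, real_inner_comm x p]
  push_cast
  ring

/-- Both sides are integrals against the reflection of `ψ` at the point of evaluation. -/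
theorem moyalForm_wignerTransform (hħ : 0 < ħ) (φ ψ : 𝓢(Config n, ℂ)) (X : 𝓢(Phase n, ℂ)) :
    moyalForm hħ (wignerTransform hħ φ ψ) X = wignerForm hħ ψ (wignerTranspose hħ φ X) := by
  ext w
  have h0 : 0 < 2 * Real.pi * ħ := by positivity
  rw [moyalForm_apply, wignerForm_eq_reflection, ← integral_wignerTransform_mul hħ]
  have hn : (((2 * Real.pi * ħ) ^ n : ℝ) : ℂ) ≠ 0 := Complex.ofReal_ne_zero.2 (pow_pos h0 n).ne'
  simp only [integral_moyal_wignerTransform]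
  rw [mul_comm 2 n, pow_mul, Complex.ofReal_pow _ 2]
  generalize (((2 * Real.pi * ħ) ^ n : ℝ) : ℂ) = c at hn
  simp only [mul_assoc _ _ (X _)]
  rw [integral_const_mul, ← mul_assoc]
  congr 1
  field_simp

/-! ### Hermitian symmetry -/

theorem conj_wignerForm (hħ : 0 < ħ) (ψ χ : 𝓢(Config n, ℂ)) :
    conjS (wignerForm hħ ψ (conjS χ)) = wignerForm hħ χ (conjS ψ) := by
  ext w
  rw [conjS_apply, wignerForm_apply, wignerForm_apply, map_mul, ← integral_conj,
    ← integral_neg_eq_self]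
  congr 1
  · rw [map_inv₀, Complex.conj_ofReal]
  · refine integral_congr_ae (Filter.Eventually.of_forall fun y => ?_)
    simp only [conjS_apply, map_mul, Complex.conj_conj, ← Complex.exp_conj, smul_neg,
      inner_neg_left, map_neg, Complex.conj_I, Complex.conj_ofReal, sub_neg_eq_add,
      ← sub_eq_add_neg]
    rw [mul_comm (χ _)]
    congr 2
    push_cast
    ring

theorem sympl_self (v : Phase n) : sympl v v = 0 := by
  rw [sympl, sub_self]

theorem sympl_sub_left (u v w : Phase n) : sympl (u - v) w = sympl u w - sympl v w := by
  simp only [sympl, Prod.fst_sub, Prod.snd_sub, inner_sub_left, inner_sub_right]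
  ring

theorem sympl_smul_left (r : ℝ) (v w : Phase n) : sympl (r • v) w = r * sympl v w := by
  simp only [sympl, Prod.smul_fst, Prod.smul_snd, inner_smul_left, inner_smul_right, conj_trivial]
  ring

theorem sympl_neg_right (v w : Phase n) : sympl v (-w) = -sympl v w := by
  simp only [sympl, Prod.fst_neg, Prod.snd_neg, inner_neg_left, inner_neg_right]
  ring

theorem integrable_moyal (w : Phase n) (Ψ X : 𝓢(Phase n, ℂ)) :
    Integrable (fun q : Phase n × Phase n =>
      Complex.exp (((ħ⁻¹ * sympl (w - q.1) q.2 : ℝ) : ℂ) * Complex.I) *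
        Ψ (q.1 - (1 / 2 : ℝ) • q.2) * X q.1) (volume.prod volume) := by
  set L : Phase n × Phase n →L[ℝ] Phase n × Phase n := ContinuousLinearMap.prod
    (ContinuousLinearMap.fst ℝ _ _ - (1 / 2 : ℝ) • ContinuousLinearMap.snd ℝ _ _)
    (ContinuousLinearMap.fst ℝ _ _) with hL
  have hLi : Function.Injective L := by
    rintro ⟨a, b⟩ ⟨a', b'⟩ h
    have h1 : a = a' := congrArg Prod.snd h
    have h2 : a - (1 / 2 : ℝ) • b = a' - (1 / 2 : ℝ) • b' := congrArg Prod.fst h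
    subst h1
    rw [smul_right_injective _ (by norm_num : (1 / 2 : ℝ) ≠ 0) (sub_right_injective h2)]
  have : ((volume : Measure (Phase n)).prod (volume : Measure (Phase n))).IsAddHaarMeasure :=
    Measure.prod.instIsAddHaarMeasure _ _
  have h1 : Integrable (pullback L hLi (tensor Ψ X)) (volume.prod volume) :=
    SchwartzMap.integrable _
  refine h1.norm.mono' ?_ (Filter.Eventually.of_forall fun q => le_of_eq ?_)
  · refine Continuous.aestronglyMeasurable ?_
    have := Ψ.continuous
    have := X.continuous
    unfold sympl
    fun_prop
  · have e : pullback L hLi (tensor Ψ X) q = Ψ (q.1 - (1 / 2 : ℝ) • q.2) * X q.1 := rfl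
    rw [e, mul_assoc, norm_mul, Complex.norm_exp_ofReal_mul_I, one_mul]

/-- For a real symbol the star operator is symmetric; for a point mass as symbol this is the
Hermitian symmetry of the form. -/
theorem conj_moyalForm (hħ : 0 < ħ) (Ψ X : 𝓢(Phase n, ℂ)) :
    conjS (moyalForm hħ Ψ (conjS X)) = moyalForm hħ X (conjS Ψ) := by
  ext w
  rw [conjS_apply, moyalForm_apply, moyalForm_apply, map_mul]
  congr 1
  · rw [map_inv₀, Complex.conj_ofReal]
  set A : Phase n → Phase n → ℂ := fun z v =>
    Complex.exp (((ħ⁻¹ * sympl (w - z) v : ℝ) : ℂ) * Complex.I) *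
      X (z - (1 / 2 : ℝ) • v) * conjS Ψ z with hA
  set B : Phase n → Phase n → ℂ := fun z v =>
    starRingEnd ℂ (Complex.exp (((ħ⁻¹ * sympl (w - z) v : ℝ) : ℂ) * Complex.I) *
      Ψ (z - (1 / 2 : ℝ) • v) * conjS X z) with hB
  have hAi : Integrable (Function.uncurry A) (volume.prod volume) := integrable_moyal w X (conjS Ψ)
  have hBi : Integrable (Function.uncurry B) (volume.prod volume) :=
    Complex.conjLIE.toLinearIsometry.toContinuousLinearMap.integrable_comp
      (integrable_moyal w Ψ (conjS X))
  -- The substitution `(z, v) ↦ (z + v/2, -v)` turns one integrand into the other.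
  have hAB : ∀ z v, B z (-v) = A (z + (1 / 2 : ℝ) • v) v := by
    intro z v
    simp only [hA, hB, conjS_apply, map_mul, Complex.conj_conj, ← Complex.exp_conj, smul_neg,
      Complex.conj_I, Complex.conj_ofReal, sub_neg_eq_add, add_sub_cancel_right]
    rw [mul_right_comm]
    congr 3
    rw [← sub_sub, sympl_sub_left _ ((1 / 2 : ℝ) • v), sympl_smul_left, sympl_self,
      sympl_neg_right]
    push_cast
    ring
  have hneg : (volume : Measure (Phase n)).IsNegInvariant :=
    Measure.IsAddHaarMeasure.isNegInvariant_of_regular _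
  calc _ = ∫ z, ∫ v, B z v := by
        rw [← integral_conj]
        refine integral_congr_ae (Filter.Eventually.of_forall fun z => ?_)
        simp only [hB]
        rw [← integral_mul_const, ← integral_conj]
    _ = ∫ v, ∫ z, B z v := integral_integral_swap hBi
    _ = ∫ v, ∫ z, B z (-v) := (integral_neg_eq_self (fun v => ∫ z, B z v) (volume : Measure (Phase n))).symm
    _ = ∫ v, ∫ z, A z v := by
        refine integral_congr_ae (Filter.Eventually.of_forall fun v => ?_)
        simp only [hAB]
        exact integral_add_right_eq_self (fun z => A z v) _
    _ = ∫ z, ∫ v, A z v := (integral_integral_swap hAi).symm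
    _ = _ := by
        refine integral_congr_ae (Filter.Eventually.of_forall fun z => ?_)
        simp only [hA]
        rw [← integral_mul_const]

theorem conjS_conjS {A : Type} [NormedAddCommGroup A] [NormedSpace ℝ A] (f : 𝓢(A, ℂ)) :
    conjS (conjS f) = f := by
  ext x
  simp only [conjS_apply, Complex.conj_conj]

theorem moyalForm_conj_wignerTransform (hħ : 0 < ħ) (φ χ : 𝓢(Config n, ℂ)) (Ψ : 𝓢(Phase n, ℂ)) :
    moyalForm hħ Ψ (conjS (wignerTransform hħ φ χ)) =
      wignerForm hħ (wignerAdjoint hħ φ Ψ) (conjS χ) := by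
  rw [← conjS_conjS (moyalForm hħ Ψ _), conj_moyalForm, moyalForm_wignerTransform, wignerAdjoint,
    ← conj_wignerForm hħ χ, conjS_conjS]

/-! ### The operators `W_φ` on square-integrable functions -/

theorem denseRange_toL2 {V : Type} [NormedAddCommGroup V] [NormedSpace ℝ V]
    [FiniteDimensional ℝ V] [MeasureSpace V] [BorelSpace V] [SecondCountableTopology V]
    [(volume : Measure V).HasTemperateGrowth]
    [IsFiniteMeasureOnCompacts (volume : Measure V)] :
    DenseRange (toL2 (V := V)) :=
  denseRange_toLpCLM (F := ℂ) (p := 2) (μ := (volume : Measure V)) ENNReal.ofNat_ne_top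

theorem eq_of_eq_on_toLp {V β : Type} [NormedAddCommGroup V] [NormedSpace ℝ V]
    [FiniteDimensional ℝ V] [MeasureSpace V] [BorelSpace V] [SecondCountableTopology V]
    [(volume : Measure V).HasTemperateGrowth]
    [IsFiniteMeasureOnCompacts (volume : Measure V)] [TopologicalSpace β] [T2Space β]
    {F G : L2 V → β}
    (hF : Continuous F) (hG : Continuous G) (h : ∀ f : 𝓢(V, ℂ), F (f.toLp 2) = G (f.toLp 2))
    (f : L2 V) : F f = G f :=
  congrFun (denseRange_toL2.equalizer hF hG (funext h)) f

theorem toTemperedDistribution_apply_eq_inner {V : Type} [NormedAddCommGroup V] [NormedSpace ℝ V]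
    [MeasureSpace V] [BorelSpace V] [SecondCountableTopology V]
    [(volume : Measure V).HasTemperateGrowth] (f : L2 V) (X : 𝓢(V, ℂ)) :
    Lp.toTemperedDistribution f X = inner ℂ ((conjS X).toLp 2) f := by
  rw [Lp.toTemperedDistribution_apply, L2.inner_def]
  refine integral_congr_ae ?_
  filter_upwards [(conjS X).coeFn_toLp 2 (volume : Measure V)] with x hx
  rw [hx, conjS_apply, RCLike.inner_apply, Complex.conj_conj, smul_eq_mul, mul_comm]

theorem inner_toLp_toLp {V : Type} [NormedAddCommGroup V] [NormedSpace ℝ V]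
    [MeasureSpace V] [BorelSpace V] [SecondCountableTopology V]
    [(volume : Measure V).HasTemperateGrowth] (f g : 𝓢(V, ℂ)) :
    inner ℂ (f.toLp 2 : L2 V) (g.toLp 2) = ∫ x, starRingEnd ℂ (f x) * g x := by
  rw [L2.inner_def]
  refine integral_congr_ae ?_
  filter_upwards [f.coeFn_toLp 2 (volume : Measure V), g.coeFn_toLp 2 (volume : Measure V)]
    with x hf hg
  rw [hf, hg, RCLike.inner_apply, mul_comm]

theorem norm_wignerL2 (hħ : 0 < ħ) (φ : 𝓢(Config n, ℂ)) (ψ : L2 (Config n)) :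
    ‖wignerL2 hħ φ ψ‖ = ‖φ.toLp 2‖ * ‖ψ‖ := by
  revert ψ
  have hF := (wignerL2 hħ φ).continuous.norm
  have hG : Continuous fun ψ : L2 (Config n) => ‖φ.toLp 2‖ * ‖ψ‖ :=
    continuous_const.mul continuous_norm
  refine eq_of_eq_on_toLp (V := Config n) hF hG fun ψ => ?_
  rw [wignerL2_toLp, norm_wignerTransform]

/-- The Hilbert space adjoint of `W_φ` preserves Schwartz functions, on which it is
`wignerAdjoint`. -/
theorem adjoint_wignerL2_toLp (hħ : 0 < ħ) (φ : 𝓢(Config n, ℂ)) (X : 𝓢(Phase n, ℂ)) :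
    ContinuousLinearMap.adjoint (wignerL2 hħ φ) (X.toLp 2) = (wignerAdjoint hħ φ X).toLp 2 := by
  have hc : ∀ f : L2 (Config n), Continuous fun ψ : L2 (Config n) => inner ℂ ψ f :=
    fun f => continuous_id.inner continuous_const
  refine ext_inner_left ℂ (eq_of_eq_on_toLp (V := Config n) (hc _) (hc _) fun ψ => ?_)
  rw [ContinuousLinearMap.adjoint_inner_right, wignerL2_toLp, inner_toLp_toLp, inner_toLp_toLp]
  have h := congrArg (starRingEnd ℂ) (integral_wignerTransform_mul hħ φ ψ (conjS X))
  rw [← integral_conj, ← integral_conj] at h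
  simp only [map_mul, conjS_apply, Complex.conj_conj] at h
  simpa only [wignerAdjoint, conjS_apply] using h

/-! ### Intertwining of the graphs -/

theorem mem_schwartzGraph_starOp (hħ : 0 < ħ) (H : 𝓢'(Phase n, ℂ)) (φ : 𝓢(Config n, ℂ))
    {q : L2 (Config n) × L2 (Config n)} (hq : q ∈ schwartzGraph (weylOp hħ H)) :
    Prod.map (wignerL2 hħ φ) (wignerL2 hħ φ) q ∈ schwartzGraph (starOp hħ H) := by
  obtain ⟨ψ, h1, h2⟩ := hq
  refine ⟨wignerTransform hħ φ ψ, ?_, ?_⟩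
  · rw [Prod.map_fst, ← h1, wignerL2_toLp]
  · ext X
    rw [starOp_apply, moyalForm_wignerTransform, ← weylOp_apply, h2,
      toTemperedDistribution_apply_eq_inner, toTemperedDistribution_apply_eq_inner, Prod.map_snd,
      ← ContinuousLinearMap.adjoint_inner_left, adjoint_wignerL2_toLp, wignerAdjoint, conjS_conjS]

theorem mem_schwartzGraph_weylOp (hħ : 0 < ħ) (H : 𝓢'(Phase n, ℂ)) (φ : 𝓢(Config n, ℂ))
    {q : L2 (Phase n) × L2 (Phase n)} (hq : q ∈ schwartzGraph (starOp hħ H)) :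
    Prod.map (ContinuousLinearMap.adjoint (wignerL2 hħ φ))
      (ContinuousLinearMap.adjoint (wignerL2 hħ φ)) q ∈ schwartzGraph (weylOp hħ H) := by
  obtain ⟨Ψ, h1, h2⟩ := hq
  refine ⟨wignerAdjoint hħ φ Ψ, ?_, ?_⟩
  · rw [Prod.map_fst, ← h1, adjoint_wignerL2_toLp]
  · ext χ
    rw [weylOp_apply, ← conjS_conjS χ, ← moyalForm_conj_wignerTransform, ← starOp_apply, h2,
      toTemperedDistribution_apply_eq_inner, toTemperedDistribution_apply_eq_inner, Prod.map_snd,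
      conjS_conjS, conjS_conjS, ContinuousLinearMap.adjoint_inner_right, wignerL2_toLp]

theorem mem_formalAdjointGraph_weylOp (hħ : 0 < ħ) (H : 𝓢'(Phase n, ℂ)) (φ : 𝓢(Config n, ℂ))
    {q : L2 (Phase n) × L2 (Phase n)} (hq : q ∈ formalAdjointGraph (starOp hħ H)) :
    Prod.map (ContinuousLinearMap.adjoint (wignerL2 hħ φ))
      (ContinuousLinearMap.adjoint (wignerL2 hħ φ)) q ∈ formalAdjointGraph (weylOp hħ H) := by
  obtain ⟨X, h1, h2⟩ := hq
  refine ⟨wignerAdjoint hħ φ X, ?_, fun θ => ?_⟩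
  · rw [Prod.map_fst, ← h1, adjoint_wignerL2_toLp]
  · rw [weylOp_apply, wignerAdjoint, conjS_conjS, ← moyalForm_wignerTransform, ← starOp_apply, h2,
      Prod.map_snd, ContinuousLinearMap.adjoint_inner_left, wignerL2_toLp]

theorem mem_formalAdjointGraph_starOp (hħ : 0 < ħ) (H : 𝓢'(Phase n, ℂ)) (φ : 𝓢(Config n, ℂ))
    {q : L2 (Config n) × L2 (Config n)} (hq : q ∈ formalAdjointGraph (weylOp hħ H)) :
    Prod.map (wignerL2 hħ φ) (wignerL2 hħ φ) q ∈ formalAdjointGraph (starOp hħ H) := by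
  obtain ⟨χ, h1, h2⟩ := hq
  refine ⟨wignerTransform hħ φ χ, ?_, fun Θ => ?_⟩
  · rw [Prod.map_fst, ← h1, wignerL2_toLp]
  · rw [starOp_apply, moyalForm_conj_wignerTransform, ← weylOp_apply, h2, Prod.map_snd,
      ← ContinuousLinearMap.adjoint_inner_right, adjoint_wignerL2_toLp]

/-- In the maximal case the weak equation for `(W_φ ψ, W_φ f)` is tested against a pair of the
formal adjoint graph of `H ⋆`, and its image under `W_φ^*` tests the equation for `(ψ, f)`. -/
theorem mem_graph_starOp (hħ : 0 < ħ) (H : 𝓢'(Phase n, ℂ)) (R : Realization)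
    (φ : 𝓢(Config n, ℂ)) {q : L2 (Config n) × L2 (Config n)}
    (hq : q ∈ R.graph (weylOp hħ H)) :
    Prod.map (wignerL2 hħ φ) (wignerL2 hħ φ) q ∈ R.graph (starOp hħ H) := by
  cases R with
  | onSchwartz => exact mem_schwartzGraph_starOp hħ H φ hq
  | closure =>
    exact map_mem_closure (by fun_prop) hq fun q hq => mem_schwartzGraph_starOp hħ H φ hq
  | maximal =>
    intro r hr
    have h := hq _ (mem_formalAdjointGraph_weylOp hħ H φ hr)
    rwa [Prod.map_fst, Prod.map_snd, ContinuousLinearMap.adjoint_inner_left,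
      ContinuousLinearMap.adjoint_inner_left] at h

theorem mem_graph_weylOp (hħ : 0 < ħ) (H : 𝓢'(Phase n, ℂ)) (R : Realization)
    (φ : 𝓢(Config n, ℂ)) {q : L2 (Phase n) × L2 (Phase n)}
    (hq : q ∈ R.graph (starOp hħ H)) :
    Prod.map (ContinuousLinearMap.adjoint (wignerL2 hħ φ))
      (ContinuousLinearMap.adjoint (wignerL2 hħ φ)) q ∈ R.graph (weylOp hħ H) := by
  cases R with
  | onSchwartz => exact mem_schwartzGraph_weylOp hħ H φ hq
  | closure =>
    exact map_mem_closure (by fun_prop) hq fun q hq => mem_schwartzGraph_weylOp hħ H φ hq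
  | maximal =>
    intro r hr
    have h := hq _ (mem_formalAdjointGraph_starOp hħ H φ hr)
    rwa [Prod.map_fst, Prod.map_snd, ← ContinuousLinearMap.adjoint_inner_right,
      ← ContinuousLinearMap.adjoint_inner_right] at h

theorem isEigenfunction_wignerL2 (hħ : 0 < ħ) (H : 𝓢'(Phase n, ℂ)) (R : Realization) {μ : ℂ}
    {ψ : L2 (Config n)} (hψ : IsEigenfunction (R.graph (weylOp hħ H)) μ ψ)
    {φ : 𝓢(Config n, ℂ)} (hφ : ‖φ.toLp 2‖ = 1) :
    IsEigenfunction (R.graph (starOp hħ H)) μ (wignerL2 hħ φ ψ) := by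
  refine ⟨?_, ?_⟩
  · rw [← norm_ne_zero_iff, norm_wignerL2, hφ, one_mul, norm_ne_zero_iff]
    exact hψ.1
  · simpa only [Prod.map_apply, map_smul] using mem_graph_starOp hħ H R φ hψ.2

theorem isEigenfunction_adjoint_wignerL2 (hħ : 0 < ħ) (H : 𝓢'(Phase n, ℂ)) (R : Realization)
    {μ : ℂ} {Ψ : L2 (Phase n)} (hΨ : IsEigenfunction (R.graph (starOp hħ H)) μ Ψ)
    {φ : 𝓢(Config n, ℂ)} (h0 : ContinuousLinearMap.adjoint (wignerL2 hħ φ) Ψ ≠ 0) :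
    IsEigenfunction (R.graph (weylOp hħ H)) μ
      (ContinuousLinearMap.adjoint (wignerL2 hħ φ) Ψ) :=
  ⟨h0, by simpa only [Prod.map_apply, map_smul] using mem_graph_weylOp hħ H R φ hΨ.2⟩

theorem exists_norm_toLp_eq_one {ψ : L2 (Config n)} (hψ : ψ ≠ 0) :
    ∃ φ : 𝓢(Config n, ℂ), ‖φ.toLp 2‖ = 1 := by
  obtain ⟨f, hf⟩ := (denseRange_toL2 (V := Config n)).exists_mem_open isOpen_compl_singleton ⟨ψ, hψ⟩
  refine ⟨((‖f.toLp 2‖⁻¹ : ℝ) : ℂ) • f, ?_⟩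
  have h : (((‖f.toLp 2‖⁻¹ : ℝ) : ℂ) • f).toLp 2 = ((‖f.toLp 2‖⁻¹ : ℝ) : ℂ) • f.toLp 2 :=
    toL2.map_smul _ _
  rw [h, norm_smul, Complex.norm_real, norm_inv, norm_norm, inv_mul_cancel₀]
  exact norm_ne_zero_iff.2 hf

/-! ### Completeness of the Wigner transforms -/

theorem exists_bump_schwartz (x : Config n) {r δ : ℝ} (hr : 0 < r) (hδ : 0 < δ) :
    ∃ f : 𝓢(Config n, ℂ), (∀ y ∈ Metric.closedBall x r, f y = 1) ∧
      (∀ y, r + δ ≤ dist y x → f y = 0) ∧ (∀ y, ‖f y‖ ≤ 1) := by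
  set b : ContDiffBump x := ⟨r, r + δ, hr, by linarith⟩ with hb
  have hc : HasCompactSupport (fun y => ((b y : ℝ) : ℂ)) :=
    b.hasCompactSupport.comp_left (g := fun t : ℝ => (t : ℂ)) Complex.ofReal_zero
  have hd : ContDiff ℝ ∞ (fun y => ((b y : ℝ) : ℂ)) :=
    Complex.ofRealCLM.contDiff.comp b.contDiff
  refine ⟨hc.toSchwartzMap hd, fun y hy => ?_, fun y hy => ?_, fun y => ?_⟩
  · change ((b y : ℝ) : ℂ) = 1
    rw [b.one_of_mem_closedBall hy, Complex.ofReal_one]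
  · change ((b y : ℝ) : ℂ) = 0
    rw [b.zero_of_le_dist hy, Complex.ofReal_zero]
  · change ‖((b y : ℝ) : ℂ)‖ ≤ 1
    rw [Complex.norm_real, Real.norm_of_nonneg b.nonneg]
    exact b.le_one

/-- A square-integrable function that is orthogonal to all tensor products has vanishing integral
over every ball: in the supremum metric of phase space a ball is a product of balls, and its
indicator function is the limit of products of bump functions. -/
theorem setIntegral_closedBall_eq_zero {G : L2 (Phase n)}
    (hG : ∀ f g : 𝓢(Config n, ℂ), inner ℂ ((tensor f g).toLp 2) G = 0) (z : Phase n) {r : ℝ}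
    (hr : 0 < r) : ∫ w in Metric.closedBall z r, G w = 0 := by
  obtain ⟨x, y⟩ := z
  have hδ : ∀ k : ℕ, 0 < 1 / ((k : ℝ) + 1) := fun k => Nat.one_div_pos_of_nat
  choose f hf1 hf0 hfb using fun k => exists_bump_schwartz x hr (hδ k)
  choose g hg1 hg0 hgb using fun k => exists_bump_schwartz y hr (hδ k)
  have hloc : LocallyIntegrable G (volume : Measure (Phase n)) :=
    (Lp.memLp G).locallyIntegrable (by norm_num)
  have hI : ∀ k, ∫ w, starRingEnd ℂ (tensor (f k) (g k) w) * G w = 0 := by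
    intro k
    rw [← hG (f k) (g k), L2.inner_def]
    refine integral_congr_ae ?_
    filter_upwards [(tensor (f k) (g k)).coeFn_toLp 2 (volume : Measure (Phase n))] with w hw
    rw [hw, RCLike.inner_apply, mul_comm]
  have hevt : ∀ t : ℝ, r < t → ∀ᶠ k : ℕ in Filter.atTop, r + 1 / ((k : ℝ) + 1) ≤ t := by
    intro t ht
    have h := (tendsto_one_div_add_atTop_nhds_zero_nat (𝕜 := ℝ)).const_add r
    rw [add_zero] at h
    exact (h.eventually_lt_const ht).mono fun k hk => hk.le
  have hlim : Filter.Tendsto (fun k => ∫ w, starRingEnd ℂ (tensor (f k) (g k) w) * G w)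
      Filter.atTop (nhds (∫ w, (Metric.closedBall (x, y) r).indicator G w)) := by
    refine tendsto_integral_of_dominated_convergence
      ((Metric.closedBall (x, y) (r + 1)).indicator fun w => ‖G w‖) (fun k => ?_) ?_ (fun k => ?_) ?_
    · exact ((Complex.continuous_conj.comp (tensor (f k) (g k)).continuous).aestronglyMeasurable).mul
        (Lp.aestronglyMeasurable G)
    · rw [integrable_indicator_iff Metric.isClosed_closedBall.measurableSet]
      exact ((hloc.integrableOn_isCompact (isCompact_closedBall _ _))).norm
    · refine Filter.Eventually.of_forall fun w => ?_
      rw [norm_mul, RCLike.norm_conj, tensor_apply, norm_mul]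
      by_cases hw : w ∈ Metric.closedBall (x, y) (r + 1)
      · rw [Set.indicator_of_mem hw]
        exact mul_le_of_le_one_left (norm_nonneg _)
          (mul_le_one₀ (hfb k _) (norm_nonneg _) (hgb k _))
      · rw [Set.indicator_of_notMem hw]
        have h1 : 1 / ((k : ℝ) + 1) ≤ 1 := by
          rw [div_le_one (by positivity)]
          linarith [Nat.cast_nonneg (α := ℝ) k]
        rw [Metric.mem_closedBall, not_le, Prod.dist_eq, lt_max_iff] at hw
        rcases hw with hw | hw
        · rw [hf0 k _ (by linarith)]
          simp
        · rw [hg0 k _ (by linarith)]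
          simp
    · refine Filter.Eventually.of_forall fun w => ?_
      refine tendsto_const_nhds.congr' ?_
      by_cases hw : w ∈ Metric.closedBall (x, y) r
      · refine Filter.Eventually.of_forall fun k => ?_
        rw [← closedBall_prod_same] at hw
        rw [← closedBall_prod_same, Set.indicator_of_mem hw]
        simp only
        rw [tensor_apply, hf1 k _ hw.1, hg1 k _ hw.2, one_mul, map_one, one_mul]
      · rw [Set.indicator_of_notMem hw]
        rw [Metric.mem_closedBall, not_le, Prod.dist_eq, lt_max_iff] at hw
        rcases hw with hw | hw
        · filter_upwards [hevt _ hw] with k hk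
          rw [tensor_apply, hf0 k _ hk, zero_mul, map_zero, zero_mul]
        · filter_upwards [hevt _ hw] with k hk
          rw [tensor_apply, hg0 k _ hk, mul_zero, map_zero, zero_mul]
  simp only [hI] at hlim
  rw [← integral_indicator Metric.isClosed_closedBall.measurableSet]
  exact tendsto_nhds_unique hlim tendsto_const_nhds

/-- Tensor products of Schwartz functions are complete in `L²`, by Lebesgue differentiation. -/
theorem eq_zero_of_inner_tensor_eq_zero {G : L2 (Phase n)}
    (hG : ∀ f g : 𝓢(Config n, ℂ), inner ℂ ((tensor f g).toLp 2) G = 0) : G = 0 := by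
  have hloc : LocallyIntegrable G (volume : Measure (Phase n)) :=
    (Lp.memLp G).locallyIntegrable (by norm_num)
  rw [Lp.eq_zero_iff_ae_eq_zero]
  filter_upwards [IsUnifLocDoublingMeasure.ae_tendsto_average (volume : Measure (Phase n)) hloc 1]
    with z hz
  have hδ : Filter.Tendsto (fun k : ℕ => 1 / ((k : ℝ) + 1)) Filter.atTop
      (nhdsWithin 0 (Set.Ioi 0)) :=
    tendsto_nhdsWithin_iff.2 ⟨tendsto_one_div_add_atTop_nhds_zero_nat,
      Filter.Eventually.of_forall fun k => Set.mem_Ioi.2 Nat.one_div_pos_of_nat⟩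
  have h := hz (fun _ => z) (fun k : ℕ => 1 / ((k : ℝ) + 1)) hδ
    (Filter.Eventually.of_forall fun k => Metric.mem_closedBall_self (by positivity))
  have h0 : ∀ k : ℕ, ⨍ w in Metric.closedBall z (1 / ((k : ℝ) + 1)), G w = 0 := fun k => by
    rw [setAverage_eq, setIntegral_closedBall_eq_zero hG z Nat.one_div_pos_of_nat, smul_zero]
  simp only [h0] at h
  exact tendsto_nhds_unique h tendsto_const_nhds

/-- Moyal's identity for arbitrary Schwartz functions in place of tensor products. -/
theorem integral_norm_sq_phaseTransform (hħ : 0 < ħ) (F : 𝓢(Phase n, ℂ)) :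
    ∫ z, ‖phaseTransform hħ F z‖ ^ 2 = ∫ z, ‖F z‖ ^ 2 := by
  have h0 : 0 < 2 * Real.pi * ħ := by positivity
  set M := pullback (midMap n) midMap_injective F with hM
  have hW : ∀ z, ‖phaseTransform hħ F z‖ ^ 2 =
      ((2 * Real.pi * ħ) ^ n)⁻¹ * ‖partialFourier (inv_ne_zero hħ.ne') M z‖ ^ 2 := by
    intro z
    rw [phaseTransform_apply, norm_mul, mul_pow, Complex.norm_real, Real.norm_eq_abs, sq_abs,
      ← Real.rpow_natCast, ← Real.rpow_mul h0.le, ← Real.rpow_natCast _ n, ← Real.rpow_neg h0.le]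
    congr 2
    push_cast
    ring
  rw [integral_phase _ (integrable_norm_sq volume _)]
  simp only [hW, integral_const_mul, integral_norm_sq_partialFourier hħ M]
  rw [← mul_assoc, inv_mul_cancel₀ (pow_pos h0 n).ne', one_mul,
    ← integral_phase _ (integrable_norm_sq volume M)]
  have h := integral_pullback_midMap (mulS F (conjS F))
  have e : ∀ z, mulS F (conjS F) z = ((‖F z‖ ^ 2 : ℝ) : ℂ) := fun z => by
    rw [mulS_apply, conjS_apply, Complex.mul_conj, Complex.normSq_eq_norm_sq]
  simp only [pullback_apply, e] at h
  exact Complex.ofReal_injective (integral_ofReal.symm.trans (h.trans integral_ofReal))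

theorem norm_phaseTransform (hħ : 0 < ħ) (F : 𝓢(Phase n, ℂ)) :
    ‖(phaseTransform hħ F).toLp 2‖ = ‖F.toLp 2‖ := by
  have h : ∀ f : 𝓢(Phase n, ℂ), ‖f.toLp 2‖ = Real.sqrt (∫ x, ‖f x‖ ^ 2) := by
    intro f
    rw [norm_toLp' (by norm_num) (by norm_num), Real.sqrt_eq_rpow]
    norm_num
  rw [h, h, integral_norm_sq_phaseTransform]

/-- The functions `W_φ ψ` span a dense subspace: only zero is orthogonal to all of them. -/
theorem eq_zero_of_inner_wignerTransform_eq_zero (hħ : 0 < ħ) {Ψ : L2 (Phase n)}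
    (hΨ : ∀ φ ψ : 𝓢(Config n, ℂ), inner ℂ ((wignerTransform hħ φ ψ).toLp 2) Ψ = 0) : Ψ = 0 := by
  -- The adjoint of the unitary extension of `phaseTransform` maps `Ψ` to a function that is
  -- orthogonal to all tensor products.
  set U : L2 (Phase n) →L[ℂ] L2 (Phase n) :=
    (toL2 ∘ₗ (phaseTransform hħ).toLinearMap).extendOfNorm toL2
  have hU : ∀ F : 𝓢(Phase n, ℂ), U (F.toLp 2) = (phaseTransform hħ F).toLp 2 :=
    LinearMap.extendOfNorm_eq (f := toL2 ∘ₗ (phaseTransform hħ).toLinearMap) (e := toL2)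
      denseRange_toL2 ⟨1, fun F => by
        rw [one_mul]
        exact (norm_phaseTransform hħ F).le⟩
  have hG : ContinuousLinearMap.adjoint U Ψ = 0 := by
    refine eq_zero_of_inner_tensor_eq_zero fun f g => ?_
    rw [ContinuousLinearMap.adjoint_inner_right, hU, ← conjS_conjS g, phaseTransform_tensor]
    exact hΨ _ _
  refine ext_inner_left ℂ fun X => ?_
  refine eq_of_eq_on_toLp (V := Phase n) (F := fun X => inner ℂ X Ψ)
    (G := fun X => inner ℂ X (0 : L2 (Phase n)))
    (continuous_id.inner continuous_const) (continuous_id.inner continuous_const) (fun X => ?_) X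
  obtain ⟨F, rfl⟩ := phaseTransform_surjective hħ X
  rw [← hU, ← ContinuousLinearMap.adjoint_inner_right, hG, inner_zero_right, inner_zero_right]

theorem exists_adjoint_wignerL2_ne_zero (hħ : 0 < ħ) {Ψ : L2 (Phase n)} (hΨ : Ψ ≠ 0) :
    ∃ φ : 𝓢(Config n, ℂ), ‖φ.toLp 2‖ = 1 ∧
      ContinuousLinearMap.adjoint (wignerL2 hħ φ) Ψ ≠ 0 := by
  by_contra! hcon
  refine hΨ (eq_zero_of_inner_wignerTransform_eq_zero hħ fun φ ψ => ?_)
  by_cases hφ : ‖φ.toLp 2‖ = 0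
  -- If `φ` vanishes, so does `W_φ ψ`.
  · have h : (wignerTransform hħ φ ψ).toLp 2 = 0 := by
      rw [← norm_eq_zero, norm_wignerTransform, hφ, zero_mul]
    rw [h, inner_zero_left]
  -- Otherwise `φ` can be normalized, since `W_φ` depends on `φ` conjugate-linearly.
  · set r : ℝ := ‖φ.toLp 2‖
    have h1 : (((r⁻¹ : ℝ) : ℂ) • φ).toLp 2 = ((r⁻¹ : ℝ) : ℂ) • φ.toLp 2 := toL2.map_smul _ _
    have h2 := hcon (((r⁻¹ : ℝ) : ℂ) • φ) (by
      rw [h1, norm_smul, Complex.norm_real, norm_inv, norm_norm, inv_mul_cancel₀ hφ])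
    have h3 : wignerTransform hħ φ ψ =
        (r : ℂ) • wignerTransform hħ (((r⁻¹ : ℝ) : ℂ) • φ) ψ := by
      have e : conjS φ = (r : ℂ) • conjS (((r⁻¹ : ℝ) : ℂ) • φ) := by
        ext x
        rw [smul_apply, conjS_apply, conjS_apply, smul_apply, smul_eq_mul, smul_eq_mul, map_mul,
          Complex.conj_ofReal, ← mul_assoc, ← Complex.ofReal_mul, mul_inv_cancel₀ hφ,
          Complex.ofReal_one, one_mul]
      rw [← phaseTransform_tensor, e, map_smul, map_smul, phaseTransform_tensor]
    have h4 : (wignerTransform hħ φ ψ).toLp 2 =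
        (r : ℂ) • wignerL2 hħ (((r⁻¹ : ℝ) : ℂ) • φ) (ψ.toLp 2) := by
      rw [h3, wignerL2_toLp]
      exact toL2.map_smul _ _
    rw [h4, inner_smul_left, ← ContinuousLinearMap.adjoint_inner_right, h2, inner_zero_right,
      mul_zero]

end PhaseSpace

/-- The eigenvalues of the Weyl operator `Ĥ` and of the star operator `H ⋆` are the same, and
`W_φ` and its adjoint map eigenfunctions to eigenfunctions with the same eigenvalue. -/
theorem mainTheorem1 (n : ℕ) (ħ : ℝ) (hħ : 0 < ħ) (H : 𝓢'(PhaseSpace.Phase n, ℂ))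
    (R : PhaseSpace.Realization) :
    (PhaseSpace.eigenvalues (R.graph (PhaseSpace.weylOp hħ H)) =
      PhaseSpace.eigenvalues (R.graph (PhaseSpace.starOp hħ H))) ∧
    (∀ (μ : ℂ) (ψ : PhaseSpace.L2 (PhaseSpace.Config n)),
      PhaseSpace.IsEigenfunction (R.graph (PhaseSpace.weylOp hħ H)) μ ψ →
      ∀ φ : 𝓢(PhaseSpace.Config n, ℂ), ‖φ.toLp 2‖ = 1 →
        PhaseSpace.IsEigenfunction (R.graph (PhaseSpace.starOp hħ H)) μ
          (PhaseSpace.wignerL2 hħ φ ψ)) ∧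
    (∀ (μ : ℂ) (Ψ : PhaseSpace.L2 (PhaseSpace.Phase n)),
      PhaseSpace.IsEigenfunction (R.graph (PhaseSpace.starOp hħ H)) μ Ψ →
      (∀ φ : 𝓢(PhaseSpace.Config n, ℂ), ‖φ.toLp 2‖ = 1 →
        ContinuousLinearMap.adjoint (PhaseSpace.wignerL2 hħ φ) Ψ ≠ 0 →
        PhaseSpace.IsEigenfunction (R.graph (PhaseSpace.weylOp hħ H)) μ
          (ContinuousLinearMap.adjoint (PhaseSpace.wignerL2 hħ φ) Ψ)) ∧
      ∃ φ : 𝓢(PhaseSpace.Config n, ℂ), ‖φ.toLp 2‖ = 1 ∧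
        ContinuousLinearMap.adjoint (PhaseSpace.wignerL2 hħ φ) Ψ ≠ 0) := by
  refine ⟨Set.ext fun μ => ⟨?_, ?_⟩, ?_, ?_⟩
  · rintro ⟨ψ, hψ⟩
    obtain ⟨φ, hφ⟩ := PhaseSpace.exists_norm_toLp_eq_one hψ.1
    exact ⟨_, PhaseSpace.isEigenfunction_wignerL2 hħ H R hψ hφ⟩
  · rintro ⟨Ψ, hΨ⟩
    obtain ⟨φ, -, hφ⟩ := PhaseSpace.exists_adjoint_wignerL2_ne_zero hħ hΨ.1
    exact ⟨_, PhaseSpace.isEigenfunction_adjoint_wignerL2 hħ H R hΨ hφ⟩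
  · exact fun μ ψ hψ φ hφ => PhaseSpace.isEigenfunction_wignerL2 hħ H R hψ hφ
  · exact fun μ Ψ hΨ => ⟨fun φ _ h0 => PhaseSpace.isEigenfunction_adjoint_wignerL2 hħ H R hΨ h0,
      PhaseSpace.exists_adjoint_wignerL2_ne_zero hħ hΨ.1⟩
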